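/- Let $n,m\ge 1$ and let $Q=A_n\otimes A_m$ be the following quiver. Its vertices are $v(i,j)$, $1\le i\le n$, $1\le j\le m$, and edges join $v(i,j)$ with $v(i\pm1,j)$ and with $v(i,j\pm1)$. Fix proper colourings $V(A_n)=\Lambda_0\sqcup\Lambda_1$ and $V(A_m)=\Lambda'_0\sqcup\Lambda'_1$; the arrows are directed $(\Lambda_0,\Lambda_0')\to(\Lambda_1,\Lambda_0')\to(\Lambda_1,\Lambda_1')\to(\Lambda_0,\Lambda_1')\to(\Lambda_0,\Lambda_0')$. Let $\epsilon:\mathrm{Vert}(Q)\to\{0,1\}$ be a bipartition, i.e. $\epsilon_u\ne\epsilon_v$ for every arrow $u\to v$. The birational $T$-system of $Q$ is the family $T_v(t)\in\mathbb Q(x_w: w\in\mathrm{Vert}(Q))$, and, for $\lambda:\mathrm{Vert}(Q)\to\mathbb R$, the tropical $T$-system is the family $\mathfrak t^\lambda_v(t)\in\mathbb R$ ($v\in \mathrm{Vert}(Q)$, $t\in\mathbb Z$, $t+\epsilon_v$ even), with $$T_v(t+1)T_v(t-1)=\prod_{u\to v}T_u(t)+\prod_{v\to w}T_w(t),\qquad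 T_v(\epsilon_v)=x_v,$$ $$\mathfrak t^\lambda_v(t+1)+\mathfrak t^\lambda_v(t-1)=\max\Big(\sum_{u\to v}\mathfrak t^\lambda_u(t),\ \sum_{v\to w}\mathfrak t^\lambda_w(t)\Big),\qquad \mathfrak t^\lambda_v(\epsilon_v)=\lambda(v).$$ When $t+\epsilon_v$ is odd, put $\mathfrak t^\lambda_v(t):=\mathfrak t^\lambda_v(t-1)$. Let $\delta_u$ be the indicator function of the vertex $u$, and put $\bar a=n+1-a$, $\bar b=m+1-b$. Then both kinds of systems exist, and the following hold for every vertex $u=v(a,b)$, with $\bar u=v(\bar a,\bar b)$. 1. Define four sequences indexed by $t=1,2,\dots,n+m$, each of which moves by one per step until it reaches its extreme value, takes the extreme value twice in a row, and then moves back by one per step: $$r_{SE}=(a+b,a+b+1,\dots,n+m,n+m,n+m-1,\dots,\bar a+\bar b),$$ $$r_{NW}=(a+b,a+b-1,\dots,3,2,2,3,\dots,\bar a+\bar b),$$ $$r_{SW}=(b-a,b-a-1,\dots,1-n,1-n,2-n,\dots,\bar b-\bar a),$$ $$r_{NE}=(b-a,b-a+1,\dots,m-1,m-1,m-2,\dots,\bar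 b-\bar a).$$ If $\epsilon_u=1$, then for $t=1,\dots,n+m$ $$\mathfrak t^{\delta_u}_{v(i,j)}(t)=\begin{cases}1,&\text{if } r_{NW}(t)\le i+j\le r_{SE}(t)\text{ and } r_{SW}(t)\le j-i\le r_{NE}(t),\\0,&\text{otherwise,}\end{cases}$$ and $\mathfrak t^{\delta_u}_v(n+m+1)=\mathfrak t^{\delta_u}_v(n+m+2)=-\delta_{\bar u}(v)$ for all $v$. If $\epsilon_u=0$, the same happens in reversed time: for $t=1,\dots,n+m$ and all $(i,j)$ with $1-t+\epsilon_{v(i,j)}$ even, $\mathfrak t^{\delta_u}_{v(i,j)}(1-t)$ is given by the right-hand side above. 2. $\mathfrak t^{\delta_u}_v(t+n+m+2)=\mathfrak t^{\delta_{\bar u}}_v(t)$ for all $v$ and all $t\in\mathbb Z$, where the system on the right is taken with respect to the bipartition $\epsilon'$ of $Q$ with $\epsilon'_{\bar u}=\epsilon_u$ (so $\epsilon'=\epsilon$ if $n+m$ is even, and $\epsilon'=1-\epsilon$ if $n+m$ is odd). 3. With $h=n+1$ and $h'=m+1$ the Coxeter numbers of $A_n$ and $A_m$, one has $\mathfrak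 t^{\lambda}_v(t+2(h+h'))=\mathfrak t^{\lambda}_v(t)$ for every $\lambda:\mathrm{Vert}(Q)\to\mathbb R$, and $T_v(t+2(h+h'))=T_v(t)$, for all $v\in\mathrm{Vert}(Q)$ and $t\in\mathbb Z$ with $t+\epsilon_v$ even; here $2(h+h')=2(n+m+2)$. -/

import Mathlib

/-- The tensor (box) product quiver of two bipartite graphs `G` and `H`, with colour classes given by
`c` and `d`. Writing `(k, l)` for the set of vertices whose colours are `k` and `l`, the arrows go
`(0,0) → (1,0) → (1,1) → (0,1) → (0,0)`. -/
def tensorQuiver {V W : Type*} {G : SimpleGraph V} {H : SimpleGraph W}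
    (c : G.Coloring (Fin 2)) (d : H.Coloring (Fin 2)) : Digraph (V × W) where
  Adj p q :=
    (p.2 = q.2 ∧ G.Adj p.1 q.1 ∧
      ((c p.1 = 0 ∧ c q.1 = 1 ∧ d p.2 = 0) ∨ (c p.1 = 1 ∧ c q.1 = 0 ∧ d p.2 = 1))) ∨
    (p.1 = q.1 ∧ H.Adj p.2 q.2 ∧
      ((d p.2 = 0 ∧ d q.2 = 1 ∧ c p.1 = 1) ∨ (d p.2 = 1 ∧ d q.2 = 0 ∧ c p.1 = 0)))

/-- `ε` is a `{0,1}`-valued function on the vertices that separates the two ends of every arrow. -/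
def IsBipartition {V : Type*} (Q : Digraph V) (ε : V → ℤ) : Prop :=
  (∀ v, ε v = 0 ∨ ε v = 1) ∧ ∀ u v, Q.Adj u v → ε u ≠ ε v

open Classical in
/-- `T t v` is the (birational) `T`-system `T_v(t)` of the quiver `Q`, with values in the field of
rational functions `ℚ(x)`. Only the values with `t + ε v` even belong to the system. -/
def IsTSystem {V : Type*} [Fintype V] (Q : Digraph V) (ε : V → ℤ)
    (T : ℤ → V → FractionRing (MvPolynomial V ℚ)) : Prop :=
  (∀ v, T (ε v) v = algebraMap (MvPolynomial V ℚ) (FractionRing (MvPolynomial V ℚ))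
    (MvPolynomial.X v)) ∧
  ∀ v t, Even (t + 1 + ε v) →
    T (t + 1) v * T (t - 1) v
      = ∏ u with Q.Adj u v, T t u + ∏ w with Q.Adj v w, T t w

open Classical in
/-- `τ t v` is the tropical `T`-system of `Q` with initial value `lam`. Only the values with
`t + ε v` even belong to the system. -/
def IsTropicalTSystem {V : Type*} [Fintype V] (Q : Digraph V) (ε : V → ℤ) (lam : V → ℝ)
    (τ : ℤ → V → ℝ) : Prop :=
  (∀ v, τ (ε v) v = lam v) ∧
  ∀ v t, Even (t + 1 + ε v) →
    τ (t + 1) v + τ (t - 1) v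
      = max (∑ u with Q.Adj u v, τ t u) (∑ w with Q.Adj v w, τ t w)

/-- The extension of a tropical `T`-system to all times: where `t + ε v` is odd, the value at time
`t - 1` is used. -/
def extendTime {V : Type*} (ε : V → ℤ) (τ : ℤ → V → ℝ) (t : ℤ) (v : V) : ℝ :=
  if Even (t + ε v) then τ t v else τ (t - 1) v

/-! The four moving diagonals, for `1 ≤ t ≤ n + m`, started at the vertex `(a, b)` with
`1 ≤ a ≤ n`, `1 ≤ b ≤ m`. Each sequence moves by one per step up to its extreme value,
takes that value twice in a row, and moves back by one per step. -/

/-- `a+b, a+b+1, …, n+m-1, n+m, n+m, n+m-1, …, (n+1-a)+(m+1-b)`. -/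
def diagSE (n m a b t : ℤ) : ℤ :=
  if t ≤ n + m - (a + b) + 1 then (a + b) + (t - 1)
  else (n + m) - (t - (n + m - (a + b) + 2))

/-- `a+b, a+b-1, …, 3, 2, 2, 3, …, (n+1-a)+(m+1-b)`. -/
def diagNW (_n _m a b t : ℤ) : ℤ :=
  if t ≤ a + b - 1 then (a + b) - (t - 1)
  else 2 + (t - (a + b))

/-- `b-a, b-a-1, …, 2-n, 1-n, 1-n, 2-n, …, (m+1-b)-(n+1-a)`. -/
def diagSW (n _m a b t : ℤ) : ℤ :=
  if t ≤ n + (b - a) then (b - a) - (t - 1)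
  else (1 - n) + (t - (n + (b - a) + 1))

/-- `b-a, b-a+1, …, m-2, m-1, m-1, m-2, …, (m+1-b)-(n+1-a)`. -/
def diagNE (_n m a b t : ℤ) : ℤ :=
  if t ≤ m - (b - a) then (b - a) + (t - 1)
  else (m - 1) - (t - (m - (b - a) + 1))

open Classical in
/-- The indicator function of the rectangle cut out by the four diagonals at time `t`, started at the
vertex `u`. The vertex `v(i, j)`, `1 ≤ i ≤ n`, `1 ≤ j ≤ m`, is the pair `(i - 1, j - 1)` in
`Fin n × Fin m`. -/
noncomputable def rectangleIndicator (n m : ℕ) (u : Fin n × Fin m) (t : ℤ) (v : Fin n × Fin m) : ℝ :=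
  let a : ℤ := (u.1 : ℕ) + 1
  let b : ℤ := (u.2 : ℕ) + 1
  let i : ℤ := (v.1 : ℕ) + 1
  let j : ℤ := (v.2 : ℕ) + 1
  if diagNW n m a b t ≤ i + j ∧ i + j ≤ diagSE n m a b t ∧
      diagSW n m a b t ≤ j - i ∧ j - i ≤ diagNE n m a b t then 1 else 0

/-- The opposite vertex `v(n+1-a, m+1-b)` of `v(a, b)`. -/
def oppositeVertex {n m : ℕ} (u : Fin n × Fin m) : Fin n × Fin m :=
  (u.1.rev, u.2.rev)

section ListDeterminant

variable {K : Type*} [Field K] {r : ℕ}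

/-- The linear functional on the exterior algebra of `K ^ r` which is the determinant in
degree `r` and vanishes in the other degrees. -/
noncomputable def volumeForm (K : Type*) [Field K] (r : ℕ) :
    ExteriorAlgebra K (Fin r → K) →ₗ[K] K :=
  ExteriorAlgebra.liftAlternating (R := K) (M := Fin r → K) (N := K)
    (Pi.single r Matrix.detRowAlternating)

/-- The product of a list of vectors in the exterior algebra. -/
noncomputable def wedge (L : List (Fin r → K)) : ExteriorAlgebra K (Fin r → K) :=
  (L.map (ExteriorAlgebra.ι K)).prod

/-- The determinant of a list of `r` vectors of `K ^ r`. -/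
noncomputable def listDet (L : List (Fin r → K)) : K := volumeForm K r (wedge L)

theorem wedge_append (L M : List (Fin r → K)) : wedge (L ++ M) = wedge L * wedge M := by
  simp [wedge]

theorem wedge_cons (a : Fin r → K) (L : List (Fin r → K)) :
    wedge (a :: L) = ExteriorAlgebra.ι K a * wedge L := by
  simp [wedge]

theorem wedge_singleton (a : Fin r → K) : wedge [a] = ExteriorAlgebra.ι K a := by
  simp [wedge]

theorem ι_mul_ι_anticomm (a b : Fin r → K) :
    ExteriorAlgebra.ι K a * ExteriorAlgebra.ι K b
      = -(ExteriorAlgebra.ι K b * ExteriorAlgebra.ι K a) :=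
  eq_neg_of_add_eq_zero_left (ExteriorAlgebra.ι_add_mul_swap a b)

theorem wedge_mul_ι (L : List (Fin r → K)) (a : Fin r → K) :
    wedge L * ExteriorAlgebra.ι K a
      = (-1 : K) ^ L.length • (ExteriorAlgebra.ι K a * wedge L) := by
  induction L with
  | nil => simp [wedge]
  | cons b L ih =>
    rw [wedge_cons, mul_assoc, ih, mul_smul_comm, ← mul_assoc, ι_mul_ι_anticomm b a, List.length_cons,
      pow_succ]
    simp [mul_assoc]

theorem listDet_ofFn (f : Fin r → Fin r → K) : listDet (List.ofFn f) = (Matrix.of f).det := by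
  have h : wedge (List.ofFn f) = ExteriorAlgebra.ιMulti K r f := by
    simp [wedge, ExteriorAlgebra.ιMulti_apply, List.map_ofFn, Function.comp_def]
  rw [listDet, h, volumeForm, ExteriorAlgebra.liftAlternating_apply_ιMulti, Pi.single_eq_same]
  rfl

theorem listDet_move (A B C : List (Fin r → K)) (a : Fin r → K) :
    listDet (A ++ B ++ a :: C) = (-1) ^ B.length * listDet (A ++ a :: (B ++ C)) := by
  have h : wedge (A ++ B ++ a :: C) = (-1 : K) ^ B.length • wedge (A ++ a :: (B ++ C)) := by
    simp only [wedge_append, wedge_cons]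
    rw [← mul_assoc, mul_assoc (wedge A), wedge_mul_ι]
    simp [mul_assoc]
  rw [listDet, h, map_smul, smul_eq_mul, listDet]

/-- The determinant as a linear functional of its last vector. -/
noncomputable def listDetLast (L : List (Fin r → K)) : (Fin r → K) →ₗ[K] K :=
  volumeForm K r ∘ₗ LinearMap.mulLeft K (wedge L) ∘ₗ ExteriorAlgebra.ι K

theorem listDetLast_apply (L : List (Fin r → K)) (x : Fin r → K) :
    listDetLast L x = listDet (L ++ [x]) := by
  simp [listDetLast, listDet, wedge_append, wedge_singleton]

/-- The determinant as a linear functional of its first vector. -/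
noncomputable def listDetHead (L : List (Fin r → K)) : (Fin r → K) →ₗ[K] K :=
  volumeForm K r ∘ₗ LinearMap.mulRight K (wedge L) ∘ₗ ExteriorAlgebra.ι K

theorem listDetHead_apply (L : List (Fin r → K)) (x : Fin r → K) :
    listDetHead L x = listDet (x :: L) := by
  simp [listDetHead, listDet, wedge_cons]

theorem listDet_cons_eq_zero_of_mem {a : Fin r → K} {L : List (Fin r → K)} (h : a ∈ L) :
    listDet (a :: L) = 0 := by
  obtain ⟨A, B, rfl⟩ := List.append_of_mem h
  have h0 : wedge (a :: (A ++ a :: B)) = 0 := by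
    rw [wedge_cons, wedge_append, wedge_cons, ← mul_assoc (wedge A), wedge_mul_ι, smul_mul_assoc,
      mul_smul_comm, mul_assoc, ← mul_assoc (ExteriorAlgebra.ι K a) (ExteriorAlgebra.ι K a)]
    simp
  simp [listDet, h0]

theorem listDet_append_singleton_eq_zero_of_mem {a : Fin r → K} {L : List (Fin r → K)}
    (h : a ∈ L) : listDet (L ++ [a]) = 0 := by
  have := listDet_move [] L [] a
  simp only [List.nil_append, List.append_nil] at this
  rw [this, listDet_cons_eq_zero_of_mem h, mul_zero]

/-- Rotating a list of `r` vectors. -/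
theorem listDet_rotate {L : List (Fin r → K)} (a : Fin r → K) (h : L.length + 1 = r) :
    listDet (L ++ [(-1 : K) ^ (r - 1) • a]) = listDet (a :: L) := by
  have h1 := listDet_move [] L [] a
  simp only [List.nil_append, List.append_nil] at h1
  rw [← listDetLast_apply, map_smul, listDetLast_apply, h1, smul_eq_mul, ← mul_assoc, ← pow_add]
  have : r - 1 + L.length = 2 * L.length := by omega
  rw [this, pow_mul]
  simp

theorem listDet_rotate_append {L M : List (Fin r → K)} (h : L.length + M.length = r) :
    listDet (M ++ L.map ((-1 : K) ^ (r - 1) • ·)) = listDet (L ++ M) := by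
  induction L generalizing M with
  | nil => simp
  | cons a L ih =>
    have h' : L.length + (M ++ [(-1 : K) ^ (r - 1) • a]).length = r := by
      simp at h ⊢; omega
    have := ih h'
    rw [← List.append_assoc, listDet_rotate a (by simp at h ⊢; omega)] at this
    simpa using this

/-- The three-term Plücker relation. -/
theorem listDet_pluecker {R : List (Fin r → K)} (hR : R.length + 2 = r) (p q x y : Fin r → K) :
    listDet (p :: q :: R) * listDet (x :: y :: R)
      = listDet (p :: x :: R) * listDet (q :: y :: R)
        - listDet (p :: y :: R) * listDet (q :: x :: R) := by
  obtain ⟨l, rfl⟩ : ∃ l, r = l + 2 := ⟨R.length, hR.symm⟩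
  obtain ⟨g, rfl⟩ : ∃ g : Fin l → Fin (l + 2) → K, List.ofFn g = R :=
    ⟨fun a => R[(a : ℕ)], List.ext_getElem (by simpa using hR.symm) (by simp)⟩
  have hdet : ∀ a b : Fin (l + 2) → K, (Matrix.of (Fin.cons a (Fin.cons b g) :
      Fin (l + 2) → Fin (l + 2) → K)).det = listDet (a :: b :: List.ofFn g) := by
    intro a b
    rw [← listDet_ofFn]
    simp [List.ofFn_succ]
  have hswap : ∀ a b : Fin (l + 2) → K, listDet (a :: b :: List.ofFn g) = - listDet (b :: a :: List.ofFn g) := by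
    intro a b
    simpa using listDet_move [] [a] (List.ofFn g) b
  set f : Fin (l + 2) → Fin (l + 2) → K := Fin.cons p (Fin.cons q g) with hf
  set M : Matrix (Fin (l + 2)) (Fin (l + 2)) K := Matrix.of f with hM
  have hc := Matrix.mulVec_cramer M.transpose x
  have hc' : M.det • x = ∑ a, (M.updateRow a x).det • f a := by
    rw [Matrix.det_transpose] at hc
    rw [← hc]
    ext b
    simp [Matrix.mulVec, dotProduct, Matrix.cramer_transpose_apply, hM, mul_comm]
  have h2 := congrArg (listDetHead (y :: List.ofFn g)) hc'
  rw [map_smul, map_sum] at h2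
  have hvan : ∀ a : Fin l, listDet (g a :: y :: List.ofFn g) = 0 := fun a =>
    listDet_cons_eq_zero_of_mem (List.mem_cons_of_mem _ (List.mem_ofFn.2 ⟨a, rfl⟩))
  have e0 : M.updateRow 0 x = Matrix.of (Fin.cons x (Fin.cons q g) : Fin (l + 2) → Fin (l + 2) → K) := by
    rw [hM, hf]
    exact Fin.update_cons_zero (α := fun _ => Fin (l + 2) → K) _ _ _
  have e1 : M.updateRow (Fin.succ 0) x
      = Matrix.of (Fin.cons p (Fin.cons x g) : Fin (l + 2) → Fin (l + 2) → K) := by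
    rw [hM, hf]
    refine (Fin.cons_update (α := fun _ => Fin (l + 2) → K) _ _ _ _).symm.trans ?_
    rw [Fin.update_cons_zero]
    rfl
  rw [Fin.sum_univ_succ, Fin.sum_univ_succ] at h2
  simp only [map_smul, smul_eq_mul, listDetHead_apply, e0, e1] at h2
  have hz : ∑ a : Fin l, (M.updateRow a.succ.succ x).det * listDet (f a.succ.succ :: y :: List.ofFn g)
      = 0 := by
    refine Finset.sum_eq_zero fun a _ => ?_
    have : f a.succ.succ = g a := rfl
    rw [this, hvan, mul_zero]
  rw [hz, hM, hf, hdet, hdet, hdet] at h2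
  rw [Fin.cons_zero, Fin.cons_succ, Fin.cons_zero, add_zero] at h2
  rw [h2, hswap x q]
  ring

/-- The octahedron relation for determinants of two blocks of vectors. -/
theorem listDet_octahedron {A B : List (Fin r → K)} (h : A.length + B.length + 2 = r)
    (p q x y : Fin r → K) :
    listDet (p :: A ++ x :: B) * listDet (A ++ [q] ++ (B ++ [y]))
      = listDet (p :: A ++ [q] ++ B) * listDet (A ++ (x :: B ++ [y]))
        + listDet (p :: A ++ (B ++ [y])) * listDet (A ++ [q] ++ x :: B) := by
  have hR : (A ++ B).length + 2 = r := by simpa using h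
  have key := listDet_pluecker hR p q x y
  have e1 : ∀ a b, listDet (a :: A ++ b :: B) = (-1) ^ A.length * listDet (a :: b :: (A ++ B)) :=
    fun a b => by simpa using listDet_move [a] A B b
  have e2 : ∀ a b, listDet (A ++ [a] ++ (B ++ [b])) = (-1) ^ B.length * listDet (a :: b :: (A ++ B)) := by
    intro a b
    have h1 := listDet_move [] A (B ++ [b]) a
    have h2 := listDet_move [a] (A ++ B) [] b
    have h3 : ((-1 : K) ^ A.length) * (-1) ^ A.length = 1 := by rw [← mul_pow]; simp
    simp only [List.nil_append, List.append_nil, List.cons_append, List.append_assoc,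
      List.length_append, pow_add] at h1 h2 ⊢
    rw [h1, h2]
    linear_combination ((-1) ^ B.length * listDet (a :: b :: (A ++ B))) * h3
  have e3 : listDet (p :: A ++ (B ++ [y]))
      = (-1) ^ A.length * (-1) ^ B.length * listDet (p :: y :: (A ++ B)) := by
    simpa [pow_add] using listDet_move [p] (A ++ B) [] y
  have e4 : listDet (A ++ [q] ++ x :: B) = listDet (q :: x :: (A ++ B)) := by
    have h1 := listDet_move [] A (x :: B) q
    have h2 := listDet_move [q] A B x
    have h3 : ((-1 : K) ^ A.length) * (-1) ^ A.length = 1 := by rw [← mul_pow]; simp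
    simp only [List.nil_append, List.cons_append, List.append_assoc] at h1 h2 ⊢
    rw [h1, h2]
    linear_combination listDet (q :: x :: (A ++ B)) * h3
  have e5 := e1 p q
  have e6 := e2 x y
  simp only [List.append_assoc, List.cons_append, List.nil_append] at e1 e2 e3 e4 e5 e6 ⊢
  rw [e1 p x, e2 q y, e3, e4, e5, e6]
  linear_combination (-(-1) ^ A.length * (-1) ^ B.length) * key

end ListDeterminant

section Frieze

/-- The list `v k, v (k + 1), …, v (k + i - 1)`. -/
def consecutive {V : Type*} (v : ℤ → V) : ℤ → ℕ → List V
  | _, 0 => []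
  | k, i + 1 => v k :: consecutive v (k + 1) i

section

variable {V : Type*} (v : ℤ → V)

theorem consecutive_zero (k : ℤ) : consecutive v k 0 = [] := rfl

theorem consecutive_succ (k : ℤ) (i : ℕ) : consecutive v k (i + 1) = v k :: consecutive v (k + 1) i := rfl

theorem length_consecutive (k : ℤ) (i : ℕ) : (consecutive v k i).length = i := by
  induction i generalizing k with
  | zero => rfl
  | succ i ih => simp [consecutive_succ, ih]

theorem consecutive_add (k : ℤ) (i j : ℕ) :
    consecutive v k (i + j) = consecutive v k i ++ consecutive v (k + i) j := by
  induction i generalizing k with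
  | zero => simp [consecutive_zero]
  | succ i ih =>
    rw [Nat.add_right_comm, consecutive_succ, consecutive_succ, ih, List.cons_append]
    push_cast
    rw [add_assoc k 1, add_comm (1 : ℤ)]

theorem consecutive_succ' (k : ℤ) (i : ℕ) : consecutive v k (i + 1) = consecutive v k i ++ [v (k + i)] := by
  rw [consecutive_add]; rfl

theorem consecutive_congr {v w : ℤ → V} {k : ℤ} {i : ℕ} (h : ∀ x, k ≤ x → x < k + i → v x = w x) :
    consecutive v k i = consecutive w k i := by
  induction i generalizing k with
  | zero => rfl
  | succ i ih =>
    rw [consecutive_succ, consecutive_succ, h k le_rfl (by push_cast; omega),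
      ih fun x h1 h2 => h x (by omega) (by push_cast; omega)]

theorem mem_consecutive {k x : ℤ} {i : ℕ} (h1 : k ≤ x) (h2 : x < k + i) : v x ∈ consecutive v k i := by
  induction i generalizing k with
  | zero => simp at h2; omega
  | succ i ih =>
    rw [consecutive_succ]
    rcases h1.eq_or_lt with rfl | h
    · exact List.mem_cons_self
    · exact List.mem_cons_of_mem _ (ih (by omega) (by push_cast at h2; omega))

theorem consecutive_eq_ofFn (k : ℤ) (i : ℕ) :
    consecutive v k i = List.ofFn fun a : Fin i => v (k + (a : ℕ)) := by
  induction i generalizing k with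
  | zero => rfl
  | succ i ih =>
    rw [consecutive_succ, ih, List.ofFn_succ]
    simp [add_assoc, add_comm (1 : ℤ)]

theorem map_consecutive {W : Type*} (f : V → W) (k : ℤ) (i : ℕ) :
    (consecutive v k i).map f = consecutive (f ∘ v) k i := by
  induction i generalizing k with
  | zero => rfl
  | succ i ih => simp [consecutive_succ, ih]

theorem consecutive_comp_add (N k : ℤ) (i : ℕ) :
    consecutive (fun x => v (x + N)) k i = consecutive v (k + N) i := by
  induction i generalizing k with
  | zero => rfl
  | succ i ih => rw [consecutive_succ, consecutive_succ, ih, add_right_comm]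

end

variable {K : Type*} [Field K]

theorem exists_forall_eq_of_triangular {V : Type*} [AddCommGroup V] [Module K V] {r : ℕ}
    (φ : Fin r → V →ₗ[K] K) (v : Fin r → V) (h0 : ∀ i a, a < i → φ i (v a) = 0)
    (hd : ∀ i, φ i (v i) ≠ 0) (b : Fin r → K) : ∃ x, ∀ i, φ i x = b i := by
  set M : Matrix (Fin r) (Fin r) K := Matrix.of fun i a => φ i (v a) with hM
  have hdet : IsUnit M.det := by
    rw [Matrix.det_of_isUpperTriangular fun i a h => by exact h0 i a h, isUnit_iff_ne_zero]
    exact Finset.prod_ne_zero_iff.2 fun i _ => hd i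
  refine ⟨∑ a, (M⁻¹.mulVec b) a • v a, fun i => ?_⟩
  have h := congrFun (Matrix.mulVec_mulVec b M M⁻¹) i
  rw [Matrix.mul_nonsing_inv _ hdet, Matrix.one_mulVec] at h
  rw [← h]
  simp [Matrix.mulVec, dotProduct, hM, mul_comm]

theorem consecutive_octahedron {r : ℕ} (v : ℤ → Fin r → K) (k l : ℤ) {i s : ℕ} (h : i + s + 2 = r) :
    listDet (consecutive v k (i + 1) ++ consecutive v l (s + 1))
        * listDet (consecutive v (k + 1) (i + 1) ++ consecutive v (l + 1) (s + 1))
      = listDet (consecutive v k (i + 2) ++ consecutive v (l + 1) s)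
          * listDet (consecutive v (k + 1) i ++ consecutive v l (s + 2))
        + listDet (consecutive v k (i + 1) ++ consecutive v (l + 1) (s + 1))
          * listDet (consecutive v (k + 1) (i + 1) ++ consecutive v l (s + 1)) := by
  have := listDet_octahedron (A := consecutive v (k + 1) i) (B := consecutive v (l + 1) s)
    (by simpa [length_consecutive] using h) (v k) (v (k + 1 + i)) (v l) (v (l + 1 + s))
  rw [consecutive_succ v k (i + 1), consecutive_succ v l (s + 1), consecutive_succ v k i, consecutive_succ v l s,
    consecutive_succ' v (k + 1) i, consecutive_succ' v (l + 1) s]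
  simpa using this

theorem exists_vectors {r : ℕ} {t : ℕ → ℕ → K} (J : ℕ) (ht0 : ∀ i, t i 0 = 1)
    (htr : ∀ j, t r j = 1) (hne : ∀ i j, i ≤ r → j ≤ J → t i j ≠ 0) :
    ∃ v : ℤ → Fin r → K, ∀ i j : ℕ, i ≤ r → j ≤ J →
      listDet (consecutive v 0 i ++ consecutive v (i + j) (r - i)) = t i j := by
  induction J with
  | zero =>
    refine ⟨fun z => if h : z.toNat < r then Pi.single ⟨z.toNat, h⟩ 1 else 0, fun i j hi hj => ?_⟩
    obtain rfl : j = 0 := by omega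
    have := consecutive_add (fun z : ℤ => if h : z.toNat < r then
      (Pi.single ⟨z.toNat, h⟩ 1 : Fin r → K) else 0) 0 i (r - i)
    rw [zero_add] at this
    rw [Nat.cast_zero, add_zero, ← this, Nat.add_sub_cancel' hi, consecutive_eq_ofFn, listDet_ofFn, ht0]
    rw [← Matrix.det_one (n := Fin r)]
    congr 1
    ext a b
    simp [Matrix.one_apply, Pi.single_apply, eq_comm]
  | succ J ih =>
    obtain ⟨v, hv⟩ := ih fun i j hi hj => hne i j hi (by omega)
    obtain ⟨x, hx⟩ := exists_forall_eq_of_triangular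
      (fun i : Fin r => listDetLast (consecutive v 0 i ++ consecutive v ((i : ℕ) + 1 + J) (r - (i + 1))))
      (fun i => v (i : ℕ))
      (by
        intro i a hai
        rw [listDetLast_apply]
        refine listDet_append_singleton_eq_zero_of_mem (List.mem_append_left _ ?_)
        exact mem_consecutive v (by omega) (by have : (a : ℕ) < i := hai; omega))
      (by
        intro i
        have h := listDet_move (consecutive v 0 i) (consecutive v ((i : ℕ) + 1 + J) (r - (i + 1))) []
          (v (i : ℕ))
        have h2 := hv (i + 1) J i.2 le_rfl
        rw [consecutive_succ'] at h2
        rw [listDetLast_apply, h, List.append_nil]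
        refine mul_ne_zero (pow_ne_zero _ (by simp)) ?_
        simp only [zero_add, List.append_assoc, List.singleton_append] at h2
        push_cast at h2
        rw [h2]
        exact hne _ _ i.2 (by omega))
      (fun i => t i (J + 1))
    refine ⟨Function.update v (r + J) x, fun i j hi hj => ?_⟩
    have hcongr : ∀ (k : ℤ) (l : ℕ), k + l ≤ r + J →
        consecutive (Function.update v (r + J) x) k l = consecutive v k l := fun k l h =>
      consecutive_congr fun z _ hz => Function.update_of_ne (by omega) _ _
    rcases Nat.lt_or_ge J j with h | h
    · obtain rfl : j = J + 1 := by omega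
      rcases hi.eq_or_lt with rfl | hi'
      · rw [hcongr _ _ (by omega), Nat.sub_self, consecutive_zero, htr, ← htr 0, ← hv i 0 le_rfl (by omega),
          Nat.sub_self, consecutive_zero]
      · rw [← hx ⟨i, hi'⟩, listDetLast_apply, hcongr _ _ (by omega)]
        obtain ⟨s, hs⟩ : ∃ s, r - i = s + 1 := ⟨r - i - 1, by omega⟩
        have hs' : r - (i + 1) = s := by omega
        rw [hs, consecutive_succ', hcongr _ _ (by push_cast; omega)]
        simp only [hs']
        have e1 : (i : ℤ) + ((J + 1 : ℕ) : ℤ) = i + 1 + J := by push_cast; ring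
        have e2 : (i : ℤ) + 1 + J + s = r + J := by omega
        rw [e1, e2, Function.update_self, List.append_assoc]
    · rw [hcongr _ _ (by omega), hcongr _ _ (by omega), hv i j hi h]

/-- The sequence of vectors with `v (k + N) = c • v k` which extends `v 0, …, v (N - 1)`. -/
def quasiPeriodic {V : Type*} [AddCommGroup V] [Module K V] (N : ℕ) (c : K) (v : ℤ → V) (k : ℤ) :
    V :=
  c ^ (k / N) • v (k % N)

theorem quasiPeriodic_add {V : Type*} [AddCommGroup V] [Module K V] {N : ℕ} (hN : N ≠ 0) {c : K}
    (hc : c ≠ 0) (v : ℤ → V) (k : ℤ) :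
    quasiPeriodic N c v (k + N) = c • quasiPeriodic N c v k := by
  have hN' : (N : ℤ) ≠ 0 := by exact_mod_cast hN
  rw [quasiPeriodic, quasiPeriodic, Int.add_emod_right, Int.add_ediv_of_dvd_right dvd_rfl,
    Int.ediv_self hN', zpow_add_one₀ hc, smul_smul, mul_comm]

theorem quasiPeriodic_of_lt {V : Type*} [AddCommGroup V] [Module K V] {N : ℕ} {c : K}
    (v : ℤ → V) {k : ℤ} (h0 : 0 ≤ k) (h : k < N) : quasiPeriodic N c v k = v k := by
  rw [quasiPeriodic, Int.emod_eq_of_lt h0 h, Int.ediv_eq_zero_of_lt h0 h, zpow_zero, one_smul]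

theorem listDet_consecutive_rotate {r : ℕ} {N : ℤ} {v : ℤ → Fin r → K}
    (hv : ∀ k, v (k + N) = (-1 : K) ^ (r - 1) • v k) (k l : ℤ) {i j : ℕ} (h : i + j = r) :
    listDet (consecutive v k i ++ consecutive v l j) = listDet (consecutive v l j ++ consecutive v (k + N) i) := by
  rw [← listDet_rotate_append (by simpa [length_consecutive] using h), map_consecutive]
  congr 2
  rw [← consecutive_comp_add]
  congr 1
  ext x : 1
  exact (hv x).symm

/-- Half periodicity of the octahedron recurrence on an `n × m` grid with boundary values `1`. -/
theorem octahedron_half_period {n m : ℕ} {Y : ℕ → ℕ → ℕ → K}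
    (hb : ∀ k i j, i = 0 ∨ i = n + 1 ∨ j = 0 ∨ j = m + 1 → Y k i j = 1)
    (hne : ∀ k i j, i ≤ n + 1 → j ≤ m + 1 → Y k i j ≠ 0)
    (hY : ∀ k i j, i < n → j < m → Y k (i + 1) (j + 1) * Y (k + 1) (i + 1) (j + 1)
      = Y k (i + 2) (j + 1) * Y (k + 1) i (j + 1) + Y k (i + 1) (j + 2) * Y (k + 1) (i + 1) j)
    {i j : ℕ} (hi : i ≤ n + 1) (hj : j ≤ m + 1) :
    Y 0 i j = Y (i + j) (n + 1 - i) (m + 1 - j) := by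
  obtain ⟨w, hw⟩ := exists_vectors (r := n + 1) (t := Y 0) (m + 1) (fun i => hb _ _ _ (by simp))
    (fun j => hb _ _ _ (by simp)) (hne 0)
  set N : ℕ := n + m + 2 with hN
  set v := quasiPeriodic N ((-1 : K) ^ n) w with hvdef
  have hper : ∀ k, v (k + N) = (-1 : K) ^ (n + 1 - 1) • v k := fun k =>
    quasiPeriodic_add (by omega) (pow_ne_zero _ (by simp)) w k
  have hv0 : ∀ i j : ℕ, i ≤ n + 1 → j ≤ m + 1 →
      listDet (consecutive v 0 i ++ consecutive v (i + j) (n + 1 - i)) = Y 0 i j := by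
    intro i j hi hj
    rw [← hw i j hi hj]
    congr 2 <;> exact consecutive_congr fun x h1 h2 => quasiPeriodic_of_lt w (by omega) (by omega)
  have hcons : ∀ k : ℤ, listDet (consecutive v k (n + 1)) = 1 := by
    have hshift : ∀ k : ℤ, listDet (consecutive v (k + N) (n + 1)) = listDet (consecutive v k (n + 1)) := by
      intro k
      have := listDet_consecutive_rotate hper k 0 (i := n + 1) (j := 0) rfl
      simpa [consecutive_zero] using this.symm
    have hsmall : ∀ k : ℕ, k < N → listDet (consecutive v k (n + 1)) = 1 := by
      intro k hk
      rcases Nat.lt_or_ge (m + 1) k with h | h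
      · obtain ⟨i, rfl⟩ : ∃ i, k = m + 1 + i := ⟨k - (m + 1), by omega⟩
        have h1 := hv0 i (m + 1) (by omega) le_rfl
        rw [listDet_consecutive_rotate hper _ _ (by omega), hb _ _ _ (by simp)] at h1
        have h2 := consecutive_add v (m + 1 + i : ℕ) (n + 1 - i) i
        rw [Nat.sub_add_cancel (by omega)] at h2
        have e1 : ((m + 1 + i : ℕ) : ℤ) + (n + 1 - i : ℕ) = 0 + N := by omega
        have e2 : (i : ℤ) + (m + 1 : ℕ) = (m + 1 + i : ℕ) := by push_cast; ring
        rw [h2, e1, ← e2, h1]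
      · have := hv0 0 k (by omega) h
        rw [hb _ _ _ (by simp)] at this
        simpa [consecutive_zero] using this
    have hmul : ∀ (q : ℕ) (k : ℤ),
        listDet (consecutive v (k + q * N) (n + 1)) = listDet (consecutive v k (n + 1)) := by
      intro q
      induction q with
      | zero => intro k; simp
      | succ q ih => intro k; rw [← ih k, ← hshift (k + q * N)]; push_cast; ring_nf
    intro k
    have hpos : (0 : ℤ) < N := by omega
    have hk := hsmall (k % N).toNat (by
      have := Int.emod_lt_of_pos k hpos; have := Int.emod_nonneg k hpos.ne'; omega)
    rw [Int.toNat_of_nonneg (Int.emod_nonneg k hpos.ne')] at hk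
    rcases Int.le_total 0 (k / N) with h | h
    · have := hmul (k / N).toNat (k % N)
      rw [Int.toNat_of_nonneg h, mul_comm, Int.emod_add_mul_ediv] at this
      rw [this, hk]
    · have := hmul (-(k / N)).toNat k
      rw [Int.toNat_of_nonneg (by omega)] at this
      rw [← this, ← hk, Int.emod_def]
      ring_nf
  set X : ℕ → ℕ → ℕ → K :=
    fun k i j => listDet (consecutive v k i ++ consecutive v (k + i + j) (n + 1 - i)) with hX
  have hXb : ∀ k i j, i ≤ n + 1 → (i = 0 ∨ i = n + 1 ∨ j = 0 ∨ j = m + 1) → X k i j = 1 := by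
    rintro k i j hi (rfl | rfl | rfl | rfl)
    · simpa [hX, consecutive_zero] using hcons (k + j)
    · simpa [hX, consecutive_zero] using hcons k
    · have := consecutive_add v k i (n + 1 - i)
      rw [Nat.add_sub_cancel' hi] at this
      simpa [hX, this] using hcons k
    · have h1 := listDet_consecutive_rotate hper k (k + i + (m + 1 : ℕ)) (i := i) (j := n + 1 - i)
        (by omega)
      have h2 := consecutive_add v (k + i + (m + 1 : ℕ)) (n + 1 - i) i
      have e1 : (k : ℤ) + i + (m + 1 : ℕ) + (n + 1 - i : ℕ) = k + N := by omega
      rw [Nat.sub_add_cancel hi, e1] at h2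
      simp only [hX]
      rw [h1, ← h2, hcons]
  have hXrec : ∀ k i j, i < n → j < m → X k (i + 1) (j + 1) * X (k + 1) (i + 1) (j + 1)
      = X k (i + 2) (j + 1) * X (k + 1) i (j + 1) + X k (i + 1) (j + 2) * X (k + 1) (i + 1) j := by
    intro k i j hi hj
    have := consecutive_octahedron v k (k + i + j + 2) (i := i) (s := n - i - 1) (r := n + 1) (by omega)
    have e1 : n + 1 - (i + 1) = n - i - 1 + 1 := by omega
    have e2 : n + 1 - (i + 2) = n - i - 1 := by omega
    have e3 : n + 1 - i = n - i - 1 + 2 := by omega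
    have a1 : (k : ℤ) + (i + 1 : ℕ) + (j + 1 : ℕ) = k + i + j + 2 := by push_cast; ring
    have a2 : ((k + 1 : ℕ) : ℤ) + (i + 1 : ℕ) + (j + 1 : ℕ) = k + i + j + 2 + 1 := by push_cast; ring
    have a3 : (k : ℤ) + (i + 2 : ℕ) + (j + 1 : ℕ) = k + i + j + 2 + 1 := by push_cast; ring
    have a4 : ((k + 1 : ℕ) : ℤ) + i + (j + 1 : ℕ) = k + i + j + 2 := by push_cast; ring
    have a5 : (k : ℤ) + (i + 1 : ℕ) + (j + 2 : ℕ) = k + i + j + 2 + 1 := by push_cast; ring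
    have a6 : ((k + 1 : ℕ) : ℤ) + (i + 1 : ℕ) + j = k + i + j + 2 := by push_cast; ring
    simp only [hX, e1, e2, e3, a1, a2, a3, a4, a5, a6]
    rw [Nat.cast_succ k, this]
  have hXY : ∀ k i j, i ≤ n + 1 → j ≤ m + 1 → X k i j = Y k i j := by
    intro k
    induction k with
    | zero =>
      intro i j hi hj
      rw [← hv0 i j hi hj]
      simp [hX]
    | succ k ihk =>
      suffices ∀ s i j, i + j = s → i ≤ n + 1 → j ≤ m + 1 → X (k + 1) i j = Y (k + 1) i j from
        fun i j => this _ i j rfl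
      intro s
      induction s using Nat.strong_induction_on with
      | _ s ihs =>
        intro i j hs hi hj
        by_cases hbd : i = 0 ∨ i = n + 1 ∨ j = 0 ∨ j = m + 1
        · rw [hXb _ _ _ hi hbd, hb _ _ _ hbd]
        · obtain ⟨i, rfl⟩ : ∃ i', i = i' + 1 := ⟨i - 1, by omega⟩
          obtain ⟨j, rfl⟩ : ∃ j', j = j' + 1 := ⟨j - 1, by omega⟩
          have h1 := hXrec k i j (by omega) (by omega)
          rw [ihk _ _ (by omega) (by omega), ihk _ _ (by omega) (by omega),
            ihk _ _ (by omega) (by omega), ihs (i + (j + 1)) (by omega) i (j + 1) rfl (by omega) hj,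
            ihs (i + 1 + j) (by omega) (i + 1) j rfl hi (by omega),
            ← hY k i j (by omega) (by omega)] at h1
          exact mul_left_cancel₀ (hne _ _ _ hi hj) h1
  rw [← hXY 0 i j hi hj, ← hXY _ _ _ (by omega) (by omega)]
  simp only [hX]
  have e1 : n + 1 - (n + 1 - i) = i := by omega
  have e2 : ((i + j : ℕ) : ℤ) + (n + 1 - i : ℕ) + (m + 1 - j : ℕ) = 0 + N := by omega
  have e3 : ((0 : ℕ) : ℤ) + i + j = (i + j : ℕ) := by push_cast; ring
  rw [e1, e2, e3, listDet_consecutive_rotate hper _ _ (by omega)]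
  simp

end Frieze

section Grid

variable {n m : ℕ}

/-- The function on the pairs `(i, j)`, `1 ≤ i ≤ n`, `1 ≤ j ≤ m`, given by `f`, extended by `1`. -/
@[to_additive]
def extendOne {M : Type*} [One M] (f : Fin n × Fin m → M) (i j : ℕ) : M :=
  if h : (0 < i ∧ i - 1 < n) ∧ (0 < j ∧ j - 1 < m) then f (⟨i - 1, h.1.2⟩, ⟨j - 1, h.2.2⟩) else 1

@[to_additive]
theorem extendOne_succ {M : Type*} [One M] (f : Fin n × Fin m → M) (v : Fin n × Fin m) :
    extendOne f (v.1 + 1) (v.2 + 1) = f v := by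
  simp [extendOne]

@[to_additive]
theorem extendOne_eq_one {M : Type*} [One M] (f : Fin n × Fin m → M) {i j : ℕ}
    (h : i = 0 ∨ i = n + 1 ∨ j = 0 ∨ j = m + 1) : extendOne f i j = 1 := by
  rw [extendOne, dif_neg]
  omega

@[to_additive]
theorem extendOne_cases {M : Type*} [One M] (n m i j : ℕ) :
    (∃ u : Fin n × Fin m, i = u.1 + 1 ∧ j = u.2 + 1 ∧ ∀ f : Fin n × Fin m → M, extendOne f i j = f u)
      ∨ ∀ f : Fin n × Fin m → M, extendOne f i j = 1 := by
  by_cases h : (0 < i ∧ i - 1 < n) ∧ (0 < j ∧ j - 1 < m)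
  · exact Or.inl ⟨(⟨i - 1, h.1.2⟩, ⟨j - 1, h.2.2⟩), by simp; omega, by simp; omega,
      fun f => by rw [extendOne, dif_pos h]⟩
  · exact Or.inr fun f => by rw [extendOne, dif_neg h]

/-- The product over the two horizontal neighbours. -/
@[to_additive]
def horizontalProd {M : Type*} [One M] [Mul M] (f : Fin n × Fin m → M) (v : Fin n × Fin m) : M :=
  extendOne f v.1 (v.2 + 1) * extendOne f (v.1 + 2) (v.2 + 1)

/-- The product over the two vertical neighbours. -/
@[to_additive]
def verticalProd {M : Type*} [One M] [Mul M] (f : Fin n × Fin m → M) (v : Fin n × Fin m) : M :=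
  extendOne f (v.1 + 1) v.2 * extendOne f (v.1 + 1) (v.2 + 2)

@[to_additive]
theorem prod_single_eq_extendOne {M : Type*} [CommMonoid M] (f : Fin n × Fin m → M) (i j : ℕ) :
    ∏ u : Fin n × Fin m, (if i = u.1 + 1 ∧ j = u.2 + 1 then f u else 1) = extendOne f i j := by
  rcases extendOne_cases (M := M) n m i j with ⟨u, hi, hj, h⟩ | h
  · rw [h, Finset.prod_eq_single u]
    · simp [hi, hj]
    · intro w _ hw
      rw [if_neg]
      rintro ⟨h1, h2⟩
      exact hw (Prod.ext (Fin.ext (by omega)) (Fin.ext (by omega)))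
    · simp
  · rw [h]
    refine Finset.prod_eq_one fun u _ => ?_
    split_ifs with hu
    · have := h f
      rwa [hu.1, hu.2, extendOne_succ] at this
    · rfl

open Classical in
@[to_additive]
theorem prod_horizontal {M : Type*} [CommMonoid M] (f : Fin n × Fin m → M) (v : Fin n × Fin m) :
    ∏ u : Fin n × Fin m with u.2 = v.2 ∧ (SimpleGraph.pathGraph n).Adj u.1 v.1, f u
      = horizontalProd f v := by
  rw [horizontalProd, ← prod_single_eq_extendOne, ← prod_single_eq_extendOne,
    ← Finset.prod_mul_distrib, Finset.prod_filter]
  refine Finset.prod_congr rfl fun u _ => ?_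
  have h1 : (u.2 = v.2 ∧ (SimpleGraph.pathGraph n).Adj u.1 v.1) ↔
      ((v.1 : ℕ) = u.1 + 1 ∧ (v.2 : ℕ) + 1 = u.2 + 1) ∨
        ((v.1 : ℕ) + 2 = u.1 + 1 ∧ (v.2 : ℕ) + 1 = u.2 + 1) := by
    rw [SimpleGraph.pathGraph_adj, Fin.ext_iff]; omega
  simp only [h1]
  by_cases h2 : (v.1 : ℕ) = u.1 + 1 ∧ (v.2 : ℕ) + 1 = u.2 + 1
  · rw [if_pos (Or.inl h2), if_pos h2, if_neg (by omega), mul_one]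
  · simp only [h2, false_or, if_false, one_mul]

open Classical in
@[to_additive]
theorem prod_vertical {M : Type*} [CommMonoid M] (f : Fin n × Fin m → M) (v : Fin n × Fin m) :
    ∏ u : Fin n × Fin m with u.1 = v.1 ∧ (SimpleGraph.pathGraph m).Adj u.2 v.2, f u
      = verticalProd f v := by
  rw [verticalProd, ← prod_single_eq_extendOne, ← prod_single_eq_extendOne,
    ← Finset.prod_mul_distrib, Finset.prod_filter]
  refine Finset.prod_congr rfl fun u _ => ?_
  have h1 : (u.1 = v.1 ∧ (SimpleGraph.pathGraph m).Adj u.2 v.2) ↔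
      ((v.1 : ℕ) + 1 = u.1 + 1 ∧ (v.2 : ℕ) = u.2 + 1) ∨
        ((v.1 : ℕ) + 1 = u.1 + 1 ∧ (v.2 : ℕ) + 2 = u.2 + 1) := by
    rw [SimpleGraph.pathGraph_adj, Fin.ext_iff]; omega
  simp only [h1]
  by_cases h2 : (v.1 : ℕ) + 1 = u.1 + 1 ∧ (v.2 : ℕ) = u.2 + 1
  · rw [if_pos (Or.inl h2), if_pos h2, if_neg (by omega), mul_one]
  · simp only [h2, false_or, if_false, one_mul]

/-- The arrows into a vertex of the tensor product of two path quivers come from the neighbours in one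
direction, the arrows out of it go to the neighbours in the other one. -/
theorem tensorQuiver_adj_cases (c : (SimpleGraph.pathGraph n).Coloring (Fin 2))
    (d : (SimpleGraph.pathGraph m).Coloring (Fin 2)) (v : Fin n × Fin m) :
    ((∀ u, (tensorQuiver c d).Adj u v ↔ u.2 = v.2 ∧ (SimpleGraph.pathGraph n).Adj u.1 v.1) ∧
      ∀ w, (tensorQuiver c d).Adj v w ↔ w.1 = v.1 ∧ (SimpleGraph.pathGraph m).Adj w.2 v.2) ∨
    ((∀ u, (tensorQuiver c d).Adj u v ↔ u.1 = v.1 ∧ (SimpleGraph.pathGraph m).Adj u.2 v.2) ∧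
      ∀ w, (tensorQuiver c d).Adj v w ↔ w.2 = v.2 ∧ (SimpleGraph.pathGraph n).Adj w.1 v.1) := by
  have hc : ∀ {a b}, (SimpleGraph.pathGraph n).Adj a b → c a ≠ c b := fun h => c.valid h
  have hd : ∀ {a b}, (SimpleGraph.pathGraph m).Adj a b → d a ≠ d b := fun h => d.valid h
  have h2 : ∀ x : Fin 2, x = 0 ∨ x = 1 := by decide
  have hflip : ∀ {x y : Fin 2}, x ≠ y → (x = 0 ↔ y = 1) ∧ (x = 1 ↔ y = 0) := by decide
  have h01 : ∀ x : Fin 2, x = 1 ↔ ¬ x = 0 := by decide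
  by_cases hcd : (c v.1 = 0 ↔ d v.2 = 0)
  · refine Or.inr ⟨fun u => ?_, fun w => ?_⟩
    · constructor
      · rintro (⟨h1, h3, h4⟩ | ⟨h1, h3, h4⟩)
        · have := hflip (hc h3); rw [h1] at h4; simp only [h01] at *; tauto
        · exact ⟨h1, h3⟩
      · rintro ⟨h1, h3⟩
        refine Or.inr ⟨h1, h3, ?_⟩
        have := hflip (hd h3); rw [h1]; simp only [h01] at *; tauto
    · constructor
      · rintro (⟨h1, h3, h4⟩ | ⟨h1, h3, h4⟩)
        · exact ⟨h1.symm, h3.symm⟩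
        · have := hflip (hd h3); simp only [h01] at *; tauto
      · rintro ⟨h1, h3⟩
        refine Or.inl ⟨h1.symm, h3.symm, ?_⟩
        have := hflip (hc h3); simp only [h01] at *; tauto
  · refine Or.inl ⟨fun u => ?_, fun w => ?_⟩
    · constructor
      · rintro (⟨h1, h3, h4⟩ | ⟨h1, h3, h4⟩)
        · exact ⟨h1, h3⟩
        · have := hflip (hd h3); rw [h1] at h4; simp only [h01] at *; tauto
      · rintro ⟨h1, h3⟩
        refine Or.inl ⟨h1, h3, ?_⟩
        have := hflip (hc h3); rw [h1]; simp only [h01] at *; tauto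
    · constructor
      · rintro (⟨h1, h3, h4⟩ | ⟨h1, h3, h4⟩)
        · have := hflip (hc h3); simp only [h01] at *; tauto
        · exact ⟨h1.symm, h3.symm⟩
      · rintro ⟨h1, h3⟩
        refine Or.inr ⟨h1.symm, h3.symm, ?_⟩
        have := hflip (hd h3); simp only [h01] at *; tauto

open Classical in
@[to_additive]
theorem tensorQuiver_prod {M α : Type*} [CommMonoid M] {g : M → M → α} (hg : ∀ x y, g x y = g y x)
    (c : (SimpleGraph.pathGraph n).Coloring (Fin 2))
    (d : (SimpleGraph.pathGraph m).Coloring (Fin 2)) (f : Fin n × Fin m → M) (v : Fin n × Fin m) :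
    g (∏ u with (tensorQuiver c d).Adj u v, f u) (∏ w with (tensorQuiver c d).Adj v w, f w)
      = g (horizontalProd f v) (verticalProd f v) := by
  rcases tensorQuiver_adj_cases c d v with ⟨h1, h2⟩ | ⟨h1, h2⟩
  · simp only [h1, h2, prod_horizontal, prod_vertical]
  · simp only [h1, h2, prod_horizontal, prod_vertical]
    exact hg _ _

/-- `ε` is a bipartition of the grid. -/
def IsGridParity (ε : Fin n × Fin m → ℤ) : Prop :=
  ∀ u v : Fin n × Fin m, Even (ε u + ε v + ((u.1 : ℕ) + (u.2 : ℕ)) + ((v.1 : ℕ) + (v.2 : ℕ)))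

theorem IsBipartition.isGridParity {c : (SimpleGraph.pathGraph n).Coloring (Fin 2)}
    {d : (SimpleGraph.pathGraph m).Coloring (Fin 2)} {ε : Fin n × Fin m → ℤ}
    (hε : IsBipartition (tensorQuiver c d) ε) : IsGridParity ε := by
  have hne : ∀ u v : Fin n × Fin m, (u.2 = v.2 ∧ (SimpleGraph.pathGraph n).Adj u.1 v.1) ∨
      (u.1 = v.1 ∧ (SimpleGraph.pathGraph m).Adj u.2 v.2) → ε u + ε v = 1 := by
    intro u v h
    have h3 : ε u ≠ ε v := by
      rcases tensorQuiver_adj_cases c d v with ⟨h1, h2⟩ | ⟨h1, h2⟩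
      · rcases h with h | h
        · exact hε.2 _ _ ((h1 u).2 h)
        · exact (hε.2 _ _ ((h2 u).2 h)).symm
      · rcases h with h | h
        · exact (hε.2 _ _ ((h2 u).2 h)).symm
        · exact hε.2 _ _ ((h1 u).2 h)
    rcases hε.1 u with h4 | h4 <;> rcases hε.1 v with h5 | h5 <;> omega
  have hcol : ∀ (i : ℕ) (hi : i < n) (b : Fin m),
      Even (ε (⟨i, hi⟩, b) + ε (⟨0, by omega⟩, b) + i) := by
    intro i
    induction i with
    | zero => intro hi b; simp
    | succ i ih =>
      intro hi b
      have h1 := ih (by omega) b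
      have h2 := hne (⟨i + 1, hi⟩, b) (⟨i, by omega⟩, b)
        (Or.inl ⟨rfl, by simp [SimpleGraph.pathGraph_adj]⟩)
      rw [Int.even_iff] at *
      push_cast
      omega
  have hrow : ∀ (j : ℕ) (hj : j < m) (a : Fin n),
      Even (ε (a, ⟨j, hj⟩) + ε (a, ⟨0, by omega⟩) + j) := by
    intro j
    induction j with
    | zero => intro hj a; simp
    | succ j ih =>
      intro hj a
      have h1 := ih (by omega) a
      have h2 := hne (a, ⟨j + 1, hj⟩) (a, ⟨j, by omega⟩)
        (Or.inr ⟨rfl, by simp [SimpleGraph.pathGraph_adj]⟩)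
      rw [Int.even_iff] at *
      push_cast
      omega
  rintro ⟨⟨a, ha⟩, ⟨b, hb⟩⟩ ⟨⟨a', ha'⟩, ⟨b', hb'⟩⟩
  have h1 := hcol a ha ⟨b, hb⟩
  have h2 := hcol a' ha' ⟨b', hb'⟩
  have h3 := hrow b hb ⟨0, by omega⟩
  have h4 := hrow b' hb' ⟨0, by omega⟩
  rw [Int.even_iff] at *
  dsimp only
  omega

/-- Induction over the pairs `(t, v)` with `t + ε v` even, in both directions of time. -/
theorem time_induction {V : Type*} {ε : V → ℤ} (hε : ∀ v, ε v = 0 ∨ ε v = 1) {p : ℤ → V → Prop}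
    (base : ∀ v, p (ε v) v)
    (up : ∀ v t, Even (t + 1 + ε v) → (∀ u, Even (t + ε u) → p t u) → p (t - 1) v → p (t + 1) v)
    (down : ∀ v t, Even (t + 1 + ε v) → (∀ u, Even (t + ε u) → p t u) → p (t + 1) v → p (t - 1) v)
    (t : ℤ) (v : V) (h : Even (t + ε v)) : p t v := by
  suffices ∀ (k : ℕ) (t : ℤ) v, (t = k ∨ t = 1 - k) → Even (t + ε v) → p t v by
    rcases Int.le_total 0 t with ht | ht
    · exact this t.toNat t v (by omega) h
    · exact this (1 - t).toNat t v (by omega) h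
  intro k
  induction k using Nat.strong_induction_on with
  | _ k ih =>
    intro t v ht hv
    rcases Nat.lt_or_ge k 2 with hk | hk
    · have : t = ε v := by
        rw [Int.even_iff] at hv
        rcases hε v with h | h <;> omega
      rw [this]; exact base v
    · rcases ht with ht | ht
      · have h1 := up v (t - 1) (by rw [Int.even_iff] at *; omega)
          (fun u hu => ih (k - 1) (by omega) _ u (by omega) hu)
          (ih (k - 2) (by omega) _ v (by omega) (by rw [Int.even_iff] at *; omega))
        rwa [sub_add_cancel] at h1
      · have h1 := down v (t + 1) (by rw [Int.even_iff] at *; omega)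
          (fun u hu => ih (k - 1) (by omega) _ u (by omega) hu)
          (ih (k - 2) (by omega) _ v (by omega) (by rw [Int.even_iff] at *; omega))
        rwa [add_sub_cancel_right] at h1

/-- A recursion of order two, run in both directions of time from the values at the times `0` and `1`. -/
theorem exists_two_sided_recursion {S : Type*} (F : S → S → S) {P : S → Prop}
    (hP : ∀ a b, P a → P b → P (F a b)) {s : S} (hs : P s) :
    ∃ x : ℤ → S, x 0 = s ∧ x 1 = s ∧ (∀ t, P (x t)) ∧ (∀ t, 1 ≤ t → x (t + 1) = F (x t) (x (t - 1))) ∧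
      ∀ t, t ≤ 0 → x (t - 1) = F (x t) (x (t + 1)) := by
  let A : ℕ → S × S := fun k => Nat.rec (s, s) (fun _ q => (q.2, F q.2 q.1)) k
  have hA1 : ∀ k, (A (k + 1)).1 = (A k).2 := fun k => rfl
  have hA2 : ∀ k, (A (k + 1)).2 = F (A k).2 (A k).1 := fun k => rfl
  have hPA : ∀ k, P (A k).1 ∧ P (A k).2 := by
    intro k
    induction k with
    | zero => exact ⟨hs, hs⟩
    | succ k ih => exact ⟨ih.2, hP _ _ ih.2 ih.1⟩
  have key : ∀ k : ℕ, 1 ≤ k → (A (k + 1)).1 = F (A k).1 (A (k - 1)).1 := by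
    intro k hk
    obtain ⟨l, rfl⟩ : ∃ l, k = l + 1 := ⟨k - 1, by omega⟩
    rw [hA1 (l + 1), hA2 l, hA1 l, Nat.add_sub_cancel]
  refine ⟨fun t => (A (max t (1 - t)).toNat).1, rfl, rfl, fun t => (hPA _).1, fun t ht => ?_,
    fun t ht => ?_⟩
  · have e1 : (max (t + 1) (1 - (t + 1))).toNat = t.toNat + 1 := by omega
    have e2 : (max t (1 - t)).toNat = t.toNat := by omega
    have e3 : (A (max (t - 1) (1 - (t - 1))).toNat).1 = (A (t.toNat - 1)).1 := by
      rcases ht.eq_or_lt with rfl | h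
      · rfl
      · congr 2; omega
    simp only [e1, e2, e3]
    exact key t.toNat (by omega)
  · have e1 : (A (max (t + 1) (1 - (t + 1))).toNat).1 = (A ((1 - t).toNat - 1)).1 := by
      rcases ht.eq_or_lt with rfl | h
      · rfl
      · congr 2; omega
    have e2 : (max t (1 - t)).toNat = (1 - t).toNat := by omega
    have e3 : (max (t - 1) (1 - (t - 1))).toNat = (1 - t).toNat + 1 := by omega
    simp only [e1, e2, e3]
    exact key (1 - t).toNat (by omega)

end Grid

section Systems

variable {n m : ℕ}

theorem oppositeVertex_oppositeVertex (v : Fin n × Fin m) :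
    oppositeVertex (oppositeVertex v) = v := by
  simp [oppositeVertex]

theorem extendOne_ne_zero {K : Type*} [Field K] {f : Fin n × Fin m → K} {i j : ℕ}
    (h : ∀ u : Fin n × Fin m, i = u.1 + 1 → j = u.2 + 1 → f u ≠ 0) : extendOne f i j ≠ 0 := by
  rcases extendOne_cases (M := K) n m i j with ⟨u, hi, hj, hu⟩ | hu
  · rw [hu]; exact h u hi hj
  · rw [hu]; exact one_ne_zero

/-- Half periodicity of the systems over a field. -/
theorem field_half_period {K : Type*} [Field K] {ε : Fin n × Fin m → ℤ} (hε : IsGridParity ε)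
    {x : ℤ → Fin n × Fin m → K} (hne : ∀ t v, Even (t + ε v) → x t v ≠ 0)
    (hx : ∀ v t, Even (t + 1 + ε v) →
      x (t + 1) v * x (t - 1) v = horizontalProd (x t) v + verticalProd (x t) v)
    (t : ℤ) (v : Fin n × Fin m) (hv : Even (t + ε v)) :
    x (t + (n + m + 2)) (oppositeVertex v) = x t v := by
  obtain ⟨⟨a, ha⟩, ⟨b, hb⟩⟩ := v
  have key := octahedron_half_period (n := n) (m := m)
    (Y := fun k i j => extendOne (x (t + 2 * k + i + j - (a + 1 + (b + 1)))) i j)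
    (fun k i j h => extendOne_eq_one _ h)
    (fun k i j hi hj => extendOne_ne_zero fun u h1 h2 => hne _ _ (by
      have := hε u (⟨a, ha⟩, ⟨b, hb⟩)
      subst h1 h2
      dsimp only at *
      rw [Int.even_iff] at *
      push_cast
      omega))
    (fun k i j hi hj => by
      have h1 := hx (⟨i, hi⟩, ⟨j, hj⟩) (t + 2 * k + (i + 1) + (j + 1) - (a + 1 + (b + 1)) + 1) (by
        have := hε (⟨i, hi⟩, ⟨j, hj⟩) (⟨a, ha⟩, ⟨b, hb⟩)
        dsimp only at *
        rw [Int.even_iff] at *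
        omega)
      rw [horizontalProd, verticalProd, ← extendOne_succ (x _) (⟨i, hi⟩, ⟨j, hj⟩),
        ← extendOne_succ (x _) (⟨i, hi⟩, ⟨j, hj⟩)] at h1
      dsimp only at h1 ⊢
      push_cast
      have e1 : t + 2 * (k : ℤ) + (i + 1) + (j + 1) - (a + 1 + (b + 1)) + 1 - 1
        = t + 2 * (k : ℤ) + (i + 1) + (j + 1) - (a + 1 + (b + 1)) := by ring
      have e2 : t + 2 * (k : ℤ) + (i + 1) + (j + 1) - (a + 1 + (b + 1)) + 1 + 1
        = t + 2 * ((k : ℤ) + 1) + (i + 1) + (j + 1) - (a + 1 + (b + 1)) := by ring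
      have e3 : t + 2 * (k : ℤ) + (i + 2) + (j + 1) - (a + 1 + (b + 1))
        = t + 2 * (k : ℤ) + (i + 1) + (j + 1) - (a + 1 + (b + 1)) + 1 := by ring
      have e4 : t + 2 * ((k : ℤ) + 1) + i + (j + 1) - (a + 1 + (b + 1))
        = t + 2 * (k : ℤ) + (i + 1) + (j + 1) - (a + 1 + (b + 1)) + 1 := by ring
      have e5 : t + 2 * (k : ℤ) + (i + 1) + (j + 2) - (a + 1 + (b + 1))
        = t + 2 * (k : ℤ) + (i + 1) + (j + 1) - (a + 1 + (b + 1)) + 1 := by ring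
      have e6 : t + 2 * ((k : ℤ) + 1) + (i + 1) + j - (a + 1 + (b + 1))
        = t + 2 * (k : ℤ) + (i + 1) + (j + 1) - (a + 1 + (b + 1)) + 1 := by ring
      rw [e1, e2] at h1
      rw [e3, e4, e5, e6, mul_comm, h1]
      ring)
    (i := a + 1) (j := b + 1) (by omega) (by omega)
  have h0 := extendOne_succ (x t) (⟨a, ha⟩, ⟨b, hb⟩)
  have h1 := extendOne_succ (x (t + (n + m + 2))) (oppositeVertex (⟨a, ha⟩, ⟨b, hb⟩))
  simp only [oppositeVertex, Fin.val_rev] at h1 ⊢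
  dsimp only at h0 key
  rw [← h0, ← h1]
  have i1 : n - (a + 1) + 1 = n + 1 - (a + 1) := by omega
  have i2 : m - (b + 1) + 1 = m + 1 - (b + 1) := by omega
  have i3 : t + 2 * ((0 : ℕ) : ℤ) + (a + 1 : ℕ) + (b + 1 : ℕ) - (a + 1 + (b + 1)) = t := by
    push_cast; ring
  have i4 : t + 2 * ((a + 1 + (b + 1) : ℕ) : ℤ) + (n + 1 - (a + 1) : ℕ) + (m + 1 - (b + 1) : ℕ)
      - (a + 1 + (b + 1)) = t + (n + m + 2) := by omega
  rw [i3, i4] at key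
  rw [i1, i2, key]

theorem period_of_half_period {α : Type*} {ε : Fin n × Fin m → ℤ} (hε : IsGridParity ε)
    {x : ℤ → Fin n × Fin m → α}
    (h : ∀ t v, Even (t + ε v) → x (t + (n + m + 2)) (oppositeVertex v) = x t v)
    (t : ℤ) (v : Fin n × Fin m) (hv : Even (t + ε v)) : x (t + 2 * ((n + 1) + (m + 1))) v = x t v := by
  rw [← h t v hv, ← h _ (oppositeVertex v), oppositeVertex_oppositeVertex]
  · congr 1; ring
  · have := hε v (oppositeVertex v)
    simp only [oppositeVertex, Fin.val_rev] at *
    rw [Int.even_iff] at *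
    omega

/-- A rational function which is a quotient of two polynomials that are positive at all positive
points. -/
def IsPositiveFraction {V : Type*} (f : FractionRing (MvPolynomial V ℚ)) : Prop :=
  ∃ p q : MvPolynomial V ℚ, (∀ y : V → ℚ, (∀ v, 0 < y v) → 0 < MvPolynomial.eval y p) ∧
    (∀ y : V → ℚ, (∀ v, 0 < y v) → 0 < MvPolynomial.eval y q) ∧
    f = algebraMap _ _ p / algebraMap _ _ q

namespace IsPositiveFraction

variable {V : Type*} {f g : FractionRing (MvPolynomial V ℚ)}

theorem algebraMap_ne_zero {p : MvPolynomial V ℚ}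
    (hp : ∀ y : V → ℚ, (∀ v, 0 < y v) → 0 < MvPolynomial.eval y p) :
    algebraMap (MvPolynomial V ℚ) (FractionRing (MvPolynomial V ℚ)) p ≠ 0 := by
  intro h
  rw [FaithfulSMul.algebraMap_eq_zero_iff] at h
  subst h
  simpa using hp (fun _ => 1) fun _ => one_pos

theorem ne_zero (hf : IsPositiveFraction f) : f ≠ 0 := by
  obtain ⟨p, q, hp, hq, rfl⟩ := hf
  exact div_ne_zero (algebraMap_ne_zero hp) (algebraMap_ne_zero hq)

theorem one : IsPositiveFraction (1 : FractionRing (MvPolynomial V ℚ)) :=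
  ⟨1, 1, by simp, by simp, by simp⟩

theorem X (v : V) : IsPositiveFraction (algebraMap (MvPolynomial V ℚ)
    (FractionRing (MvPolynomial V ℚ)) (MvPolynomial.X v)) :=
  ⟨MvPolynomial.X v, 1, fun y hy => by simpa using hy v, by simp, by simp⟩

theorem mul (hf : IsPositiveFraction f) (hg : IsPositiveFraction g) :
    IsPositiveFraction (f * g) := by
  obtain ⟨p, q, hp, hq, rfl⟩ := hf
  obtain ⟨p', q', hp', hq', rfl⟩ := hg
  exact ⟨p * p', q * q', fun y hy => by simpa using mul_pos (hp y hy) (hp' y hy),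
    fun y hy => by simpa using mul_pos (hq y hy) (hq' y hy), by simp [div_mul_div_comm]⟩

theorem div (hf : IsPositiveFraction f) (hg : IsPositiveFraction g) :
    IsPositiveFraction (f / g) := by
  obtain ⟨p, q, hp, hq, rfl⟩ := hf
  obtain ⟨p', q', hp', hq', rfl⟩ := hg
  exact ⟨p * q', q * p', fun y hy => by simpa using mul_pos (hp y hy) (hq' y hy),
    fun y hy => by simpa using mul_pos (hq y hy) (hp' y hy), by simp [div_div_div_eq]⟩

theorem add (hf : IsPositiveFraction f) (hg : IsPositiveFraction g) :
    IsPositiveFraction (f + g) := by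
  obtain ⟨p, q, hp, hq, rfl⟩ := hf
  obtain ⟨p', q', hp', hq', rfl⟩ := hg
  exact ⟨p * q' + q * p', q * q', fun y hy => by
      simpa using add_pos (mul_pos (hp y hy) (hq' y hy)) (mul_pos (hq y hy) (hp' y hy)),
    fun y hy => by simpa using mul_pos (hq y hy) (hq' y hy), by
      simp [div_add_div _ _ (algebraMap_ne_zero hq) (algebraMap_ne_zero hq')]⟩

end IsPositiveFraction

/-- A set of positive elements is closed under the right hand side of the recursion. -/
theorem horizontalProd_add_verticalProd_mem {K : Type*} [Field K] {P : K → Prop} (h1 : P 1)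
    (hmul : ∀ a b, P a → P b → P (a * b)) (hadd : ∀ a b, P a → P b → P (a + b))
    {f : Fin n × Fin m → K} {v : Fin n × Fin m}
    (hf : ∀ u : Fin n × Fin m, Odd (((u.1 : ℕ) + (u.2 : ℕ) + (v.1 : ℕ) + (v.2 : ℕ) : ℤ)) → P (f u)) :
    P (horizontalProd f v + verticalProd f v) := by
  have hext : ∀ i j : ℕ, Odd ((i + j + (v.1 : ℕ) + (v.2 : ℕ) : ℤ)) → P (extendOne f i j) := by
    intro i j hij
    rcases extendOne_cases (M := K) n m i j with ⟨u, hi, hj, hu⟩ | hu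
    · rw [hu]
      refine hf u ?_
      subst hi hj
      rw [Int.odd_iff] at *
      push_cast at hij
      omega
    · rw [hu]; exact h1
  refine hadd _ _ (hmul _ _ (hext _ _ ?_) (hext _ _ ?_)) (hmul _ _ (hext _ _ ?_) (hext _ _ ?_)) <;>
  · rw [Int.odd_iff]; push_cast; omega

theorem exists_system {K : Type*} [Field K] {P : K → Prop} (h0 : ∀ a, P a → a ≠ 0) (h1 : P 1)
    (hmul : ∀ a b, P a → P b → P (a * b)) (hadd : ∀ a b, P a → P b → P (a + b))
    (hdiv : ∀ a b, P a → P b → P (a / b)) {s : Fin n × Fin m → K} (hs : ∀ v, P (s v)) :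
    ∃ x : ℤ → Fin n × Fin m → K, x 0 = s ∧ x 1 = s ∧ (∀ t v, P (x t v)) ∧
      ∀ v t, x (t + 1) v * x (t - 1) v = horizontalProd (x t) v + verticalProd (x t) v := by
  obtain ⟨x, hx0, hx1, hP, hup, hdown⟩ := exists_two_sided_recursion
    (fun a b : Fin n × Fin m → K => fun v => (horizontalProd a v + verticalProd a v) / b v)
    (P := fun a => ∀ v, P (a v))
    (fun a b ha hb v => hdiv _ _
      (horizontalProd_add_verticalProd_mem h1 hmul hadd fun u _ => ha u) (hb v)) hs
  refine ⟨x, hx0, hx1, hP, fun v t => ?_⟩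
  rcases lt_or_ge t 1 with ht | ht
  · rw [hdown t (by omega), mul_div_cancel₀ _ (h0 _ (hP _ _))]
  · rw [hup t ht, div_mul_cancel₀ _ (h0 _ (hP _ _))]

theorem exists_tropical_system (s : Fin n × Fin m → ℝ) :
    ∃ x : ℤ → Fin n × Fin m → ℝ, x 0 = s ∧ x 1 = s ∧
      ∀ v t, x (t + 1) v + x (t - 1) v = max (horizontalSum (x t) v) (verticalSum (x t) v) := by
  obtain ⟨x, hx0, hx1, -, hup, hdown⟩ := exists_two_sided_recursion
    (fun a b : Fin n × Fin m → ℝ => fun v => max (horizontalSum a v) (verticalSum a v) - b v)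
    (P := fun _ => True) (fun _ _ _ _ => trivial) (s := s) trivial
  refine ⟨x, hx0, hx1, fun v t => ?_⟩
  rcases lt_or_ge t 1 with ht | ht
  · rw [hdown t (by omega), add_sub_cancel]
  · rw [hup t ht, sub_add_cancel]

/-- Positivity spreads from the initial values to the whole system. -/
theorem system_mem {K : Type*} [Field K] {P : K → Prop} (h0 : ∀ a, P a → a ≠ 0) (h1 : P 1)
    (hmul : ∀ a b, P a → P b → P (a * b)) (hadd : ∀ a b, P a → P b → P (a + b))
    (hdiv : ∀ a b, P a → P b → P (a / b)) {ε : Fin n × Fin m → ℤ} (hε : ∀ v, ε v = 0 ∨ ε v = 1)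
    (hpar : IsGridParity ε) {x : ℤ → Fin n × Fin m → K} (hs : ∀ v, P (x (ε v) v))
    (hx : ∀ v t, Even (t + 1 + ε v) →
      x (t + 1) v * x (t - 1) v = horizontalProd (x t) v + verticalProd (x t) v)
    (t : ℤ) (v : Fin n × Fin m) (hv : Even (t + ε v)) : P (x t v) := by
  have hR : ∀ v t, Even (t + 1 + ε v) → (∀ u, Even (t + ε u) → P (x t u)) →
      P (x (t + 1) v * x (t - 1) v) := by
    intro v t ht h
    rw [hx v t ht]
    refine horizontalProd_add_verticalProd_mem h1 hmul hadd fun u hu => h u ?_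
    have := hpar u v
    rw [Int.odd_iff] at hu
    rw [Int.even_iff] at *
    omega
  refine time_induction (p := fun t v => P (x t v)) hε hs (fun v t ht h hp => ?_) (fun v t ht h hp => ?_) t v hv
  · have := hdiv _ _ (hR v t ht h) hp
    rwa [mul_div_cancel_right₀ _ (h0 _ hp)] at this
  · have := hdiv _ _ (hR v t ht h) hp
    rwa [mul_div_cancel_left₀ _ (h0 _ hp)] at this

theorem abs_log_add_sub_max_le {a b α β C D : ℝ} (ha : 0 < a) (hb : 0 < b)
    (hα : |Real.log a - α| ≤ C) (hβ : |Real.log b - β| ≤ D) :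
    |Real.log (a + b) - max α β| ≤ C + D + Real.log 2 := by
  have hC := (abs_nonneg _).trans hα
  have hD := (abs_nonneg _).trans hβ
  have h2 : 0 < Real.log 2 := Real.log_pos (by norm_num)
  rw [abs_le] at *
  have h3 : Real.log a ≤ Real.log (a + b) := Real.log_le_log ha (by linarith)
  have h4 : Real.log b ≤ Real.log (a + b) := Real.log_le_log hb (by linarith)
  constructor
  · rcases max_cases α β with ⟨h, -⟩ | ⟨h, -⟩ <;> rw [h] <;> linarith
  · rcases le_total a b with hab | hab
    · have : Real.log (a + b) ≤ Real.log (2 * b) := Real.log_le_log (by linarith) (by linarith)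
      rw [Real.log_mul (by norm_num) hb.ne'] at this
      have := le_max_right α β
      linarith
    · have : Real.log (a + b) ≤ Real.log (2 * a) := Real.log_le_log (by linarith) (by linarith)
      rw [Real.log_mul (by norm_num) ha.ne'] at this
      have := le_max_left α β
      linarith

/-- Half periodicity of the tropical systems. -/
theorem tropical_half_period {ε : Fin n × Fin m → ℤ} (hε : ∀ v, ε v = 0 ∨ ε v = 1)
    (hpar : IsGridParity ε) {τ : ℤ → Fin n × Fin m → ℝ}
    (hτ : ∀ v t, Even (t + 1 + ε v) →
      τ (t + 1) v + τ (t - 1) v = max (horizontalSum (τ t) v) (verticalSum (τ t) v))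
    (t : ℤ) (v : Fin n × Fin m) (hv : Even (t + ε v)) :
    τ (t + (n + m + 2)) (oppositeVertex v) = τ t v := by
  have hX := fun s : ℕ => exists_system (n := n) (m := m) (P := fun a : ℝ => 0 < a)
    (fun _ h => h.ne') one_pos (fun _ _ => mul_pos) (fun _ _ => add_pos) (fun _ _ => div_pos)
    (s := fun v => Real.exp (s * τ (ε v) v)) (fun v => Real.exp_pos _)
  choose X hX0 hX1 hpos hX using hX
  have hbound : ∀ t v, Even (t + ε v) →
      ∃ C, ∀ s : ℕ, |Real.log (X s t v) - s * τ t v| ≤ C := by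
    have hR : ∀ v t, Even (t + 1 + ε v) →
        (∀ u, Even (t + ε u) → ∃ C, ∀ s : ℕ, |Real.log (X s t u) - s * τ t u| ≤ C) →
        ∃ C, ∀ s : ℕ, |(Real.log (X s (t + 1) v) + Real.log (X s (t - 1) v))
          - (s * τ (t + 1) v + s * τ (t - 1) v)| ≤ C := by
      intro v t ht h
      have hext : ∀ i j : ℕ, Odd ((i + j + (v.1 : ℕ) + (v.2 : ℕ) : ℤ)) → ∃ C, ∀ s : ℕ,
          0 < extendOne (X s t) i j ∧
          |Real.log (extendOne (X s t) i j) - s * extendZero (τ t) i j| ≤ C := by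
        intro i j hij
        by_cases hin : (0 < i ∧ i - 1 < n) ∧ (0 < j ∧ j - 1 < m)
        · obtain ⟨C, hC⟩ := h (⟨i - 1, hin.1.2⟩, ⟨j - 1, hin.2.2⟩) (by
            have := hpar (⟨i - 1, hin.1.2⟩, ⟨j - 1, hin.2.2⟩) v
            rw [Int.odd_iff] at hij
            rw [Int.even_iff] at *
            dsimp only at *
            omega)
          refine ⟨C, fun s => ?_⟩
          rw [extendOne, dif_pos hin, extendZero, dif_pos hin]
          exact ⟨hpos _ _ _, hC s⟩
        · refine ⟨0, fun s => ?_⟩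
          rw [extendOne, dif_neg hin, extendZero, dif_neg hin]
          simp
      have hmul : ∀ i j i' j' : ℕ, Odd ((i + j + (v.1 : ℕ) + (v.2 : ℕ) : ℤ)) →
          Odd ((i' + j' + (v.1 : ℕ) + (v.2 : ℕ) : ℤ)) → ∃ C, ∀ s : ℕ,
          0 < extendOne (X s t) i j * extendOne (X s t) i' j' ∧
          |Real.log (extendOne (X s t) i j * extendOne (X s t) i' j')
            - s * (extendZero (τ t) i j + extendZero (τ t) i' j')| ≤ C := by
        intro i j i' j' h1 h2
        obtain ⟨C, hC⟩ := hext i j h1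
        obtain ⟨D, hD⟩ := hext i' j' h2
        refine ⟨C + D, fun s => ⟨mul_pos (hC s).1 (hD s).1, ?_⟩⟩
        rw [Real.log_mul (hC s).1.ne' (hD s).1.ne', mul_add, add_sub_add_comm]
        exact (abs_add_le _ _).trans (add_le_add (hC s).2 (hD s).2)
      obtain ⟨C, hC⟩ := hmul v.1 (v.2 + 1) (v.1 + 2) (v.2 + 1)
        (by rw [Int.odd_iff]; push_cast; omega) (by rw [Int.odd_iff]; push_cast; omega)
      obtain ⟨D, hD⟩ := hmul (v.1 + 1) v.2 (v.1 + 1) (v.2 + 2)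
        (by rw [Int.odd_iff]; push_cast; omega) (by rw [Int.odd_iff]; push_cast; omega)
      refine ⟨C + D + Real.log 2, fun s => ?_⟩
      rw [← Real.log_mul (hpos _ _ _).ne' (hpos _ _ _).ne', hX, ← mul_add, hτ v t ht,
        mul_max_of_nonneg _ _ (Nat.cast_nonneg s)]
      exact abs_log_add_sub_max_le (hC s).1 (hD s).1 (hC s).2 (hD s).2
    refine time_induction hε (fun v => ⟨0, fun s => ?_⟩) (fun v t ht h hp => ?_)
      (fun v t ht h hp => ?_)
    · have : X s (ε v) v = Real.exp (s * τ (ε v) v) := by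
        rcases hε v with h | h
        · have := congrFun (hX0 s) v
          rwa [← h] at this
        · have := congrFun (hX1 s) v
          rwa [← h] at this
      rw [this, Real.log_exp]
      simp
    · obtain ⟨C, hC⟩ := hR v t ht h
      obtain ⟨D, hD⟩ := hp
      refine ⟨C + D, fun s => ?_⟩
      have h1 := abs_le.1 (hC s)
      have h2 := abs_le.1 (hD s)
      exact abs_le.2 ⟨by linarith, by linarith⟩
    · obtain ⟨C, hC⟩ := hR v t ht h
      obtain ⟨D, hD⟩ := hp
      refine ⟨C + D, fun s => ?_⟩
      have h1 := abs_le.1 (hC s)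
      have h2 := abs_le.1 (hD s)
      exact abs_le.2 ⟨by linarith, by linarith⟩
  obtain ⟨C, hC⟩ := hbound t v hv
  obtain ⟨D, hD⟩ := hbound (t + (n + m + 2)) (oppositeVertex v) (by
    have := hpar v (oppositeVertex v)
    simp only [oppositeVertex, Fin.val_rev] at *
    rw [Int.even_iff] at *
    omega)
  have hper : ∀ s, X s (t + (n + m + 2)) (oppositeVertex v) = X s t v := fun s =>
    field_half_period hpar (fun t v _ => (hpos s t v).ne') (fun v t _ => hX s v t) t v hv
  by_contra hne
  have hlt : 0 < |τ (t + (n + m + 2)) (oppositeVertex v) - τ t v| :=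
    abs_pos.2 (sub_ne_zero.2 hne)
  obtain ⟨s, hs⟩ := exists_nat_gt ((C + D) / |τ (t + (n + m + 2)) (oppositeVertex v) - τ t v|)
  rw [div_lt_iff₀ hlt] at hs
  have h1 := hC s
  have h2 := hD s
  rw [hper, abs_sub_comm] at h2
  have h3 := abs_add_le (s * τ (t + (n + m + 2)) (oppositeVertex v) - Real.log (X s t v))
    (Real.log (X s t v) - s * τ t v)
  rw [sub_add_sub_cancel, ← mul_sub, abs_mul, Nat.abs_cast] at h3
  linarith

/-- A tropical system is determined by its initial values. -/
theorem tropical_unique {ε : Fin n × Fin m → ℤ} (hε : ∀ v, ε v = 0 ∨ ε v = 1)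
    (hpar : IsGridParity ε) {τ τ' : ℤ → Fin n × Fin m → ℝ} (h0 : ∀ v, τ (ε v) v = τ' (ε v) v)
    (hτ : ∀ v t, Even (t + 1 + ε v) →
      τ (t + 1) v + τ (t - 1) v = max (horizontalSum (τ t) v) (verticalSum (τ t) v))
    (hτ' : ∀ v t, Even (t + 1 + ε v) →
      τ' (t + 1) v + τ' (t - 1) v = max (horizontalSum (τ' t) v) (verticalSum (τ' t) v))
    (t : ℤ) (v : Fin n × Fin m) (hv : Even (t + ε v)) : τ t v = τ' t v := by
  have hR : ∀ v t, Even (t + 1 + ε v) → (∀ u, Even (t + ε u) → τ t u = τ' t u) →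
      τ (t + 1) v + τ (t - 1) v = τ' (t + 1) v + τ' (t - 1) v := by
    intro v t ht h
    have hext : ∀ i j : ℕ, Odd ((i + j + (v.1 : ℕ) + (v.2 : ℕ) : ℤ)) →
        extendZero (τ t) i j = extendZero (τ' t) i j := by
      intro i j hij
      rcases extendZero_cases (M := ℝ) n m i j with ⟨u, hi, hj, hu⟩ | hu
      · rw [hu, hu]
        refine h u ?_
        have := hpar u v
        subst hi hj
        rw [Int.odd_iff] at hij
        rw [Int.even_iff] at *
        push_cast at hij
        omega
      · rw [hu, hu]
    rw [hτ v t ht, hτ' v t ht, horizontalSum, verticalSum, horizontalSum, verticalSum,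
      hext _ _ ?_, hext _ _ ?_, hext _ _ ?_, hext _ _ ?_]
    all_goals rw [Int.odd_iff]; push_cast; omega
  refine time_induction (p := fun t v => τ t v = τ' t v) hε h0 (fun v t ht h hp => ?_) (fun v t ht h hp => ?_) t v hv
  · have := hR v t ht h
    rw [hp] at this
    linarith
  · have := hR v t ht h
    rw [hp] at this
    linarith

end Systems

section Rectangle

/-- The points of the moving rectangle at time `t`, where each side is given by two inequalities, one for
the time before and one for the time after its reflection. -/
def InRectangle (n m a b t i j : ℤ) : Prop :=
  ((0 < i ∧ i ≤ n) ∧ 0 < j ∧ j ≤ m) ∧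
  (a + b + 1 - t ≤ i + j ∧ t + 2 - a - b ≤ i + j) ∧
  (i + j ≤ a + b + t - 1 ∧ i + j ≤ 2 * n + 2 * m + 2 - a - b - t) ∧
  (b - a + 1 - t ≤ j - i ∧ t - 2 * n - b + a ≤ j - i) ∧
  j - i ≤ b - a + t - 1 ∧ j - i ≤ 2 * m - b + a - t

namespace InRectangle

variable {n m a b t i j : ℤ}

theorem neighbours_of_both (hi : 0 < i ∧ i ≤ n) (hj : 0 < j ∧ j ≤ m)
    (hpar : (t + i + j + a + b) % 2 = 0)
    (h1 : InRectangle n m a b (t + 1) i j) (h2 : InRectangle n m a b (t - 1) i j) :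
    (InRectangle n m a b t (i - 1) j ∧ InRectangle n m a b t (i + 1) j) ∨
      (InRectangle n m a b t i (j - 1) ∧ InRectangle n m a b t i (j + 1)) := by
  unfold InRectangle at *
  by_cases h : i = 1 ∨ i = n
  · right; omega
  · left; omega

theorem both_of_neighbours (hi : 0 < i ∧ i ≤ n) (hj : 0 < j ∧ j ≤ m)
    (hpar : (t + i + j + a + b) % 2 = 0)
    (h : (InRectangle n m a b t (i - 1) j ∧ InRectangle n m a b t (i + 1) j) ∨
      (InRectangle n m a b t i (j - 1) ∧ InRectangle n m a b t i (j + 1))) :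
    InRectangle n m a b (t + 1) i j ∧ InRectangle n m a b (t - 1) i j := by
  unfold InRectangle at *
  rcases h with h | h <;> omega

theorem or_of_neighbour (ha : 0 < a ∧ a ≤ n) (hb : 0 < b ∧ b ≤ m) (hi : 0 < i ∧ i ≤ n)
    (hj : 0 < j ∧ j ≤ m) (hpar : (t + i + j + a + b) % 2 = 0)
    (h : (InRectangle n m a b t (i - 1) j ∨ InRectangle n m a b t (i + 1) j) ∨
      (InRectangle n m a b t i (j - 1) ∨ InRectangle n m a b t i (j + 1))) :
    InRectangle n m a b (t + 1) i j ∨ InRectangle n m a b (t - 1) i j := by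
  unfold InRectangle at *
  rcases h with (h | h) | (h | h) <;> omega

theorem neighbour_of_or (ha : 0 < a ∧ a ≤ n) (hb : 0 < b ∧ b ≤ m) (hi : 0 < i ∧ i ≤ n)
    (hj : 0 < j ∧ j ≤ m) (ht : 1 ≤ t ∧ t + 1 ≤ n + m) (hpar : (t + i + j + a + b) % 2 = 0)
    (h : InRectangle n m a b (t + 1) i j ∨ InRectangle n m a b (t - 1) i j) :
    (InRectangle n m a b t (i - 1) j ∨ InRectangle n m a b t (i + 1) j) ∨
      (InRectangle n m a b t i (j - 1) ∨ InRectangle n m a b t i (j + 1)) := by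
  unfold InRectangle at *
  rcases h with h | h <;> omega

theorem sub_one_iff (hpar : (t + i + j + a + b) % 2 = 0) :
    InRectangle n m a b (t - 1) i j ↔ InRectangle n m a b t i j := by
  unfold InRectangle
  constructor <;> intro h <;> omega

end InRectangle

theorem indicator_add_eq_max {P Q A B C D : Prop} [Decidable P] [Decidable Q] [Decidable A]
    [Decidable B] [Decidable C] [Decidable D] (h1 : P ∧ Q ↔ (A ∧ B) ∨ (C ∧ D))
    (h2 : P ∨ Q ↔ (A ∨ B) ∨ (C ∨ D)) :
    ((if P then 1 else 0) + (if Q then 1 else 0) : ℝ)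
      = max ((if A then 1 else 0) + (if B then 1 else 0))
        ((if C then 1 else 0) + (if D then 1 else 0)) := by
  by_cases hA : A <;> by_cases hB : B <;> by_cases hC : C <;> by_cases hD : D <;>
    by_cases hP : P <;> by_cases hQ : Q <;> simp_all

variable {n m : ℕ}

open Classical in
theorem rectangleIndicator_eq (u v : Fin n × Fin m) (t : ℤ) :
    rectangleIndicator n m u t v
      = if InRectangle n m ((u.1 : ℕ) + 1) ((u.2 : ℕ) + 1) t ((v.1 : ℕ) + 1) ((v.2 : ℕ) + 1)
        then 1 else 0 := by
  have h1 := u.1.2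
  have h2 := u.2.2
  have h3 := v.1.2
  have h4 := v.2.2
  unfold rectangleIndicator InRectangle diagNW diagSE diagSW diagNE
  dsimp only
  congr 1
  apply propext
  constructor
  · rintro ⟨h5, h6, h7, h8⟩
    split_ifs at h5 h6 h7 h8 <;> omega
  · rintro ⟨-, h5, h6, h7, h8⟩
    refine ⟨?_, ?_, ?_, ?_⟩ <;> split_ifs <;> omega

open Classical in
theorem extendZero_rectangleIndicator (u : Fin n × Fin m) (t : ℤ) (i j : ℕ) :
    extendZero (rectangleIndicator n m u t) i j
      = if InRectangle n m ((u.1 : ℕ) + 1) ((u.2 : ℕ) + 1) t i j then 1 else 0 := by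
  by_cases h : (0 < i ∧ i - 1 < n) ∧ (0 < j ∧ j - 1 < m)
  · rw [extendZero, dif_pos h, rectangleIndicator_eq]
    have e1 : ((i - 1 : ℕ) : ℤ) + 1 = i := by omega
    have e2 : ((j - 1 : ℕ) : ℤ) + 1 = j := by omega
    simp only [e1, e2]
  · rw [extendZero, dif_neg h, if_neg]
    rintro ⟨h1, -⟩
    omega

theorem rectangleIndicator_recursion (u v : Fin n × Fin m) {t : ℤ} (ht : 1 ≤ t ∧ t + 1 ≤ n + m)
    (hpar : (t + (v.1 : ℕ) + (v.2 : ℕ) + (u.1 : ℕ) + (u.2 : ℕ)) % 2 = 0) :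
    rectangleIndicator n m u (t + 1) v + rectangleIndicator n m u (t - 1) v
      = max (horizontalSum (rectangleIndicator n m u t) v)
        (verticalSum (rectangleIndicator n m u t) v) := by
  classical
  have h1 : 0 < ((u.1 : ℕ) : ℤ) + 1 ∧ ((u.1 : ℕ) : ℤ) + 1 ≤ n := by have := u.1.2; omega
  have h2 : 0 < ((u.2 : ℕ) : ℤ) + 1 ∧ ((u.2 : ℕ) : ℤ) + 1 ≤ m := by have := u.2.2; omega
  have h3 : 0 < ((v.1 : ℕ) : ℤ) + 1 ∧ ((v.1 : ℕ) : ℤ) + 1 ≤ n := by have := v.1.2; omega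
  have h4 : 0 < ((v.2 : ℕ) : ℤ) + 1 ∧ ((v.2 : ℕ) : ℤ) + 1 ≤ m := by have := v.2.2; omega
  have h5 : (t + (((v.1 : ℕ) : ℤ) + 1) + (((v.2 : ℕ) : ℤ) + 1) + (((u.1 : ℕ) : ℤ) + 1)
    + (((u.2 : ℕ) : ℤ) + 1)) % 2 = 0 := by omega
  have e1 : ((v.1 : ℕ) : ℤ) + 1 - 1 = (v.1 : ℕ) := by ring
  have e2 : ((v.2 : ℕ) : ℤ) + 1 - 1 = (v.2 : ℕ) := by ring
  have e3 : ((v.1 : ℕ) : ℤ) + 1 + 1 = (v.1 + 2 : ℕ) := by push_cast; ring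
  have e4 : ((v.2 : ℕ) : ℤ) + 1 + 1 = (v.2 + 2 : ℕ) := by push_cast; ring
  have k1 := InRectangle.neighbours_of_both h3 h4 h5
  have k2 := InRectangle.both_of_neighbours h3 h4 h5
  have k3 := InRectangle.or_of_neighbour h1 h2 h3 h4 h5
  have k4 := InRectangle.neighbour_of_or h1 h2 h3 h4 ht h5
  rw [e1, e2, e3, e4] at k1 k2 k3 k4
  simp only [horizontalSum, verticalSum, extendZero_rectangleIndicator, rectangleIndicator_eq]
  push_cast at k1 k2 k3 k4 ⊢
  exact indicator_add_eq_max ⟨fun h => k1 h.1 h.2, k2⟩ ⟨k4, k3⟩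

theorem rectangleIndicator_sub_one (u v : Fin n × Fin m) {t : ℤ}
    (hpar : (t + (v.1 : ℕ) + (v.2 : ℕ) + (u.1 : ℕ) + (u.2 : ℕ)) % 2 = 0) :
    rectangleIndicator n m u (t - 1) v = rectangleIndicator n m u t v := by
  classical
  rw [rectangleIndicator_eq, rectangleIndicator_eq, InRectangle.sub_one_iff]
  omega

theorem rectangleIndicator_zero (u v : Fin n × Fin m) : rectangleIndicator n m u 0 v = 0 := by
  classical
  rw [rectangleIndicator_eq, if_neg]
  unfold InRectangle
  omega

theorem rectangleIndicator_one (u v : Fin n × Fin m) :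
    rectangleIndicator n m u 1 v = (Pi.single u 1 : Fin n × Fin m → ℝ) v := by
  classical
  rw [rectangleIndicator_eq, Pi.single_apply]
  congr 1
  apply propext
  have h1 := u.1.2
  have h2 := u.2.2
  rw [Prod.ext_iff, Fin.ext_iff, Fin.ext_iff]
  unfold InRectangle
  omega

theorem rectangleIndicator_last (u v : Fin n × Fin m)
    (hpar : (n + m + 1 + (v.1 : ℕ) + (v.2 : ℕ) + (u.1 : ℕ) + (u.2 : ℕ) : ℤ) % 2 = 0) :
    rectangleIndicator n m u (n + m) v = 0 := by
  classical
  rw [rectangleIndicator_eq, if_neg]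
  unfold InRectangle
  omega

/-- The tropical systems, written for functions on the grid. -/
theorem IsTropicalTSystem.grid {c : (SimpleGraph.pathGraph n).Coloring (Fin 2)}
    {d : (SimpleGraph.pathGraph m).Coloring (Fin 2)} {ε : Fin n × Fin m → ℤ}
    {lam : Fin n × Fin m → ℝ} {τ : ℤ → Fin n × Fin m → ℝ}
    (h : IsTropicalTSystem (tensorQuiver c d) ε lam τ) (v : Fin n × Fin m) (t : ℤ)
    (ht : Even (t + 1 + ε v)) :
    τ (t + 1) v + τ (t - 1) v = max (horizontalSum (τ t) v) (verticalSum (τ t) v) := by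
  rw [h.2 v t ht, tensorQuiver_sum max_comm]

theorem tropical_eq_rectangleIndicator {ε : Fin n × Fin m → ℤ} (hε : ∀ v, ε v = 0 ∨ ε v = 1)
    (hpar : IsGridParity ε) {τ : ℤ → Fin n × Fin m → ℝ} {u : Fin n × Fin m} (hu : ε u = 1)
    (h0 : ∀ v, τ (ε v) v = (Pi.single u 1 : Fin n × Fin m → ℝ) v)
    (hτ : ∀ v t, Even (t + 1 + ε v) →
      τ (t + 1) v + τ (t - 1) v = max (horizontalSum (τ t) v) (verticalSum (τ t) v))
    (k : ℕ) (hk : k ≤ n + m) (v : Fin n × Fin m) (hv : Even (k + ε v)) :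
    τ k v = rectangleIndicator n m u k v := by
  induction k using Nat.strong_induction_on generalizing v with
  | _ k ih =>
    match k with
    | 0 =>
      have h : ε v = 0 := by
        rw [Int.even_iff] at hv
        rcases hε v with h | h
        · exact h
        · rw [h] at hv; norm_num at hv
      have h1 := h0 v
      rw [h, Pi.single_apply, if_neg] at h1
      · rw [Nat.cast_zero, h1, rectangleIndicator_zero]
      · rintro rfl; omega
    | 1 =>
      have h : ε v = 1 := by
        rw [Int.even_iff] at hv
        rcases hε v with h | h
        · rw [h] at hv; norm_num at hv
        · exact h
      have h1 := h0 v
      rw [h] at h1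
      rw [Nat.cast_one, h1, rectangleIndicator_one]
    | k + 2 =>
      have hpv := hpar u v
      have hext : ∀ i j : ℕ, Odd ((i + j + (v.1 : ℕ) + (v.2 : ℕ) : ℤ)) →
          extendZero (τ (k + 1)) i j = extendZero (rectangleIndicator n m u (k + 1)) i j := by
        intro i j hij
        rcases extendZero_cases (M := ℝ) n m i j with ⟨w, hi, hj, hw⟩ | hw
        · rw [hw, hw]
          have h1 := ih (k + 1) (by omega) (by omega) w (by
            have := hpar w v
            subst hi hj
            rw [Int.odd_iff] at hij
            rw [Int.even_iff] at *
            push_cast at *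
            omega)
          exact_mod_cast h1
        · rw [hw, hw]
      have h1 := hτ v (k + 1) (by push_cast at hv; convert hv using 1; ring)
      have h2 := rectangleIndicator_recursion u v (t := k + 1) (by omega) (by
        rw [Int.even_iff] at *; push_cast at hv; omega)
      rw [horizontalSum, verticalSum, hext _ _ (by rw [Int.odd_iff]; push_cast; omega),
        hext _ _ (by rw [Int.odd_iff]; push_cast; omega),
        hext _ _ (by rw [Int.odd_iff]; push_cast; omega),
        hext _ _ (by rw [Int.odd_iff]; push_cast; omega), ← horizontalSum, ← verticalSum, ← h2] at h1
      have h3 := ih k (by omega) (by omega) v (by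
        rw [Int.even_iff] at *; push_cast at hv; omega)
      have e1 : (k : ℤ) + 1 - 1 = k := by ring
      have e2 : (k : ℤ) + 1 + 1 = (k + 2 : ℕ) := by push_cast; ring
      rw [e1, e2, h3] at h1
      exact add_right_cancel h1

end Rectangle

section HalfPeriod

variable {n m : ℕ}

theorem extendZero_oppositeVertex (f : Fin n × Fin m → ℝ) {i j i' j' : ℕ} (hi : i + i' = n + 1)
    (hj : j + j' = m + 1) :
    extendZero (fun v => f (oppositeVertex v)) i j = extendZero f i' j' := by
  by_cases h : (0 < i ∧ i - 1 < n) ∧ (0 < j ∧ j - 1 < m)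
  · rw [extendZero, dif_pos h, extendZero, dif_pos (by omega)]
    congr 1
    refine Prod.ext (Fin.ext ?_) (Fin.ext ?_) <;> simp only [oppositeVertex, Fin.val_rev] <;> omega
  · rw [extendZero, dif_neg h, extendZero, dif_neg (by omega)]

theorem horizontalSum_oppositeVertex (f : Fin n × Fin m → ℝ) (v : Fin n × Fin m) :
    horizontalSum (fun v => f (oppositeVertex v)) v = horizontalSum f (oppositeVertex v) := by
  have h1 := v.1.2
  have h2 := v.2.2
  rw [horizontalSum, horizontalSum, add_comm]
  congr 1 <;> apply extendZero_oppositeVertex <;> simp only [oppositeVertex, Fin.val_rev] <;> omega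

theorem verticalSum_oppositeVertex (f : Fin n × Fin m → ℝ) (v : Fin n × Fin m) :
    verticalSum (fun v => f (oppositeVertex v)) v = verticalSum f (oppositeVertex v) := by
  have h1 := v.1.2
  have h2 := v.2.2
  rw [verticalSum, verticalSum, add_comm]
  congr 1 <;> apply extendZero_oppositeVertex <;> simp only [oppositeVertex, Fin.val_rev] <;> omega

theorem IsGridParity.oppositeVertex {ε : Fin n × Fin m → ℤ} (hpar : IsGridParity ε)
    (v : Fin n × Fin m) : (ε (oppositeVertex v) + ε v + n + m) % 2 = 0 := by
  have := hpar v (_root_.oppositeVertex v)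
  have h1 := v.1.2
  have h2 := v.2.2
  simp only [_root_.oppositeVertex, Fin.val_rev] at *
  rw [Int.even_iff] at this
  omega

theorem single_oppositeVertex (u v : Fin n × Fin m) (x : ℝ) :
    (Pi.single (oppositeVertex u) x : Fin n × Fin m → ℝ) v
      = (Pi.single u x : Fin n × Fin m → ℝ) (oppositeVertex v) := by
  rw [Pi.single_apply, Pi.single_apply]
  congr 1
  apply propext
  constructor
  · rintro rfl; exact oppositeVertex_oppositeVertex u
  · rintro rfl; exact (oppositeVertex_oppositeVertex v).symm

theorem extendTime_eq_rectangleIndicator {ε : Fin n × Fin m → ℤ} (hε : ∀ v, ε v = 0 ∨ ε v = 1)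
    (hpar : IsGridParity ε) {τ : ℤ → Fin n × Fin m → ℝ} {u : Fin n × Fin m} (hu : ε u = 1)
    (h0 : ∀ v, τ (ε v) v = (Pi.single u 1 : Fin n × Fin m → ℝ) v)
    (hτ : ∀ v t, Even (t + 1 + ε v) →
      τ (t + 1) v + τ (t - 1) v = max (horizontalSum (τ t) v) (verticalSum (τ t) v))
    (t : ℤ) (h1 : 1 ≤ t) (h2 : t ≤ n + m) (v : Fin n × Fin m) :
    extendTime ε τ t v = rectangleIndicator n m u t v := by
  rw [extendTime]
  split_ifs with hv
  · have := tropical_eq_rectangleIndicator hε hpar hu h0 hτ t.toNat (by omega) v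
    rw [Int.toNat_of_nonneg (by omega)] at this
    exact this hv
  · have hp := hpar u v
    have := tropical_eq_rectangleIndicator hε hpar hu h0 hτ (t - 1).toNat (by omega) v
    rw [Int.toNat_of_nonneg (by omega)] at this
    rw [this (by rw [Int.even_iff] at *; omega), rectangleIndicator_sub_one u v (by
      rw [Int.even_iff] at *; omega)]

theorem extendTime_half_period {ε : Fin n × Fin m → ℤ} (hε : ∀ v, ε v = 0 ∨ ε v = 1)
    (hpar : IsGridParity ε) {τ : ℤ → Fin n × Fin m → ℝ} {u : Fin n × Fin m} (hu : ε u = 1)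
    (h0 : ∀ v, τ (ε v) v = (Pi.single u 1 : Fin n × Fin m → ℝ) v)
    (hτ : ∀ v t, Even (t + 1 + ε v) →
      τ (t + 1) v + τ (t - 1) v = max (horizontalSum (τ t) v) (verticalSum (τ t) v))
    (t : ℤ) (ht : t = n + m + 1 ∨ t = n + m + 2) (v : Fin n × Fin m) :
    extendTime ε τ t v = (Pi.single (oppositeVertex u) (-1) : Fin n × Fin m → ℝ) v := by
  have hev : ∀ v, ε v = 0 → τ 0 v = 0 := by
    intro v hv
    have := h0 v
    rw [hv, Pi.single_apply, if_neg] at this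
    · exact this
    · rintro rfl; omega
  have hodd : ∀ v, ε v = 1 → τ (-1) v = (Pi.single u (-1) : Fin n × Fin m → ℝ) v := by
    intro v hv
    have hext : ∀ i j : ℕ, Odd ((i + j + (v.1 : ℕ) + (v.2 : ℕ) : ℤ)) → extendZero (τ 0) i j = 0 := by
      intro i j hij
      rcases extendZero_cases (M := ℝ) n m i j with ⟨w, hi, hj, hw⟩ | hw
      · rw [hw]
        refine hev w ?_
        have := hpar w v
        subst hi hj
        rw [Int.odd_iff] at hij
        rw [Int.even_iff] at *
        push_cast at *
        rcases hε w with h | h <;> omega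
      · rw [hw]
    have h1 := hτ v 0 (by rw [hv]; decide)
    rw [horizontalSum, verticalSum, hext _ _ (by rw [Int.odd_iff]; push_cast; omega),
      hext _ _ (by rw [Int.odd_iff]; push_cast; omega),
      hext _ _ (by rw [Int.odd_iff]; push_cast; omega),
      hext _ _ (by rw [Int.odd_iff]; push_cast; omega), zero_add, zero_sub, add_zero, max_self] at h1
    have h2 := h0 v
    rw [hv] at h2
    rw [eq_neg_of_add_eq_zero_right h1, h2, Pi.single_neg, Pi.neg_apply]
  have hper := tropical_half_period hε hpar hτ
  have hopp := hpar.oppositeVertex v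
  have hne : ε (oppositeVertex v) = 0 →
      (Pi.single (oppositeVertex u) (-1) : Fin n × Fin m → ℝ) v = 0 := by
    intro h
    rw [single_oppositeVertex, Pi.single_apply, if_neg]
    intro h'
    rw [h'] at h
    omega
  have hfirst : ε (oppositeVertex v) = 1 →
      τ (n + m + 1) v = (Pi.single (oppositeVertex u) (-1) : Fin n × Fin m → ℝ) v := by
    intro h
    have h1 := hper (-1) (oppositeVertex v) (by rw [h]; decide)
    rw [oppositeVertex_oppositeVertex, hodd _ h] at h1
    rw [single_oppositeVertex, ← h1]
    congr 1
    ring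
  rw [extendTime]
  have hpv := hpar u v
  have hcases := hε (oppositeVertex v)
  rcases ht with rfl | rfl <;> split_ifs with hv
  · exact hfirst (by rw [Int.even_iff] at hv; omega)
  · rw [Int.even_iff] at *
    rw [hne (by omega), add_sub_cancel_right]
    have h1 := tropical_eq_rectangleIndicator hε hpar hu h0 hτ (n + m) le_rfl v (by
      rw [Int.even_iff]; push_cast; omega)
    push_cast at h1
    rw [h1, rectangleIndicator_last u v (by omega)]
  · rw [Int.even_iff] at hv
    have h : ε (oppositeVertex v) = 0 := by omega
    have h1 := hper 0 (oppositeVertex v) (by rw [h]; decide)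
    rw [oppositeVertex_oppositeVertex, hev _ h, zero_add] at h1
    rw [h1, hne h]
  · rw [Int.even_iff] at hv
    rw [← hfirst (by omega)]
    congr 1
    ring

theorem extendTime_add_half_period {ε ε' : Fin n × Fin m → ℤ} (hε : ∀ v, ε v = 0 ∨ ε v = 1)
    (hpar : IsGridParity ε) (hε' : ∀ v, ε' v = 0 ∨ ε' v = 1) (hpar' : IsGridParity ε')
    {u : Fin n × Fin m} (hu : ε' (oppositeVertex u) = ε u) {τ τ' : ℤ → Fin n × Fin m → ℝ}
    (h0 : ∀ v, τ (ε v) v = (Pi.single u 1 : Fin n × Fin m → ℝ) v)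
    (hτ : ∀ v t, Even (t + 1 + ε v) →
      τ (t + 1) v + τ (t - 1) v = max (horizontalSum (τ t) v) (verticalSum (τ t) v))
    (h0' : ∀ v, τ' (ε' v) v = (Pi.single (oppositeVertex u) 1 : Fin n × Fin m → ℝ) v)
    (hτ' : ∀ v t, Even (t + 1 + ε' v) →
      τ' (t + 1) v + τ' (t - 1) v = max (horizontalSum (τ' t) v) (verticalSum (τ' t) v))
    (t : ℤ) (v : Fin n × Fin m) :
    extendTime ε τ (t + (n + m + 2)) v = extendTime ε' τ' t v := by
  have hopp : ∀ v, ε (oppositeVertex v) = ε' v := by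
    intro v
    have h1 := hpar.oppositeVertex v
    have h2 := hpar.oppositeVertex u
    have h3 := hpar u v
    have h4 := hpar' (oppositeVertex u) v
    have h5 := hpar (oppositeVertex u) v
    rw [Int.even_iff] at h3 h4 h5
    have := hε (oppositeVertex v)
    have := hε' v
    omega
  have key : ∀ t v, Even (t + ε' v) → τ' t v = τ (t + (n + m + 2)) v := by
    intro t v hv
    have h1 := tropical_half_period hε hpar hτ t (oppositeVertex v) (by rwa [hopp])
    rw [oppositeVertex_oppositeVertex] at h1
    rw [h1]
    refine tropical_unique hε' hpar' (τ' := fun t v => τ t (oppositeVertex v))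
      (fun v => ?_) hτ' (fun v t ht => ?_) t v hv
    · rw [h0' v, ← hopp v, h0 (oppositeVertex v), single_oppositeVertex]
    · rw [horizontalSum_oppositeVertex, verticalSum_oppositeVertex]
      exact hτ _ _ (by rwa [hopp])
  have h1 := hpar.oppositeVertex v
  have h2 := hopp v
  rw [extendTime, extendTime]
  by_cases hv : Even (t + ε' v)
  · rw [if_pos hv, if_pos (by rw [Int.even_iff] at *; omega), key t v hv]
  · rw [if_neg hv, if_neg (by rw [Int.even_iff] at *; omega), key (t - 1) v (by
      rw [Int.even_iff] at *; omega)]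
    congr 1
    ring

end HalfPeriod

theorem mainTheorem11 (n m : ℕ)
    (c : (SimpleGraph.pathGraph n).Coloring (Fin 2))
    (d : (SimpleGraph.pathGraph m).Coloring (Fin 2))
    (ε : Fin n × Fin m → ℤ) (hε : IsBipartition (tensorQuiver c d) ε) :
    -- the systems exist
    (∀ lam : Fin n × Fin m → ℝ, ∃ τ, IsTropicalTSystem (tensorQuiver c d) ε lam τ) ∧
    (∃ T, IsTSystem (tensorQuiver c d) ε T) ∧
    -- the moving rectangle, for `ε u = 1`, followed by minus the indicator of the opposite vertex
    (∀ (u : Fin n × Fin m) (τ : ℤ → Fin n × Fin m → ℝ),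
      IsTropicalTSystem (tensorQuiver c d) ε (Pi.single u 1) τ → ε u = 1 →
        (∀ t : ℤ, 1 ≤ t → t ≤ n + m → ∀ v,
          extendTime ε τ t v = rectangleIndicator n m u t v) ∧
        (∀ t : ℤ, t = n + m + 1 ∨ t = n + m + 2 → ∀ v,
          extendTime ε τ t v = (Pi.single (oppositeVertex u) (-1) : Fin n × Fin m → ℝ) v)) ∧
    -- for `ε u = 0` the same rectangle appears with time reversed
    (∀ (u : Fin n × Fin m) (τ : ℤ → Fin n × Fin m → ℝ),
      IsTropicalTSystem (tensorQuiver c d) ε (Pi.single u 1) τ → ε u = 0 →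
        ∀ t : ℤ, 1 ≤ t → t ≤ n + m → ∀ v, Even (1 - t + ε v) →
          τ (1 - t) v = rectangleIndicator n m u t v) ∧
    -- after half a period the system starts again from the opposite vertex, with the bipartition
    -- for which the opposite vertex has the colour of `u`
    (∀ (u : Fin n × Fin m) (ε' : Fin n × Fin m → ℤ) (τ τ' : ℤ → Fin n × Fin m → ℝ),
      IsBipartition (tensorQuiver c d) ε' → ε' (oppositeVertex u) = ε u →
      IsTropicalTSystem (tensorQuiver c d) ε (Pi.single u 1) τ →
      IsTropicalTSystem (tensorQuiver c d) ε' (Pi.single (oppositeVertex u) 1) τ' →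
        ∀ (t : ℤ) v, extendTime ε τ (t + (n + m + 2)) v = extendTime ε' τ' t v) ∧
    -- periodicity of the tropical and of the birational system, with `h = n + 1`, `h' = m + 1`
    (∀ (lam : Fin n × Fin m → ℝ) (τ : ℤ → Fin n × Fin m → ℝ),
      IsTropicalTSystem (tensorQuiver c d) ε lam τ →
        ∀ (t : ℤ) v, Even (t + ε v) → τ (t + 2 * ((n + 1) + (m + 1))) v = τ t v) ∧
    (∀ T : ℤ → Fin n × Fin m → FractionRing (MvPolynomial (Fin n × Fin m) ℚ),
      IsTSystem (tensorQuiver c d) ε T →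
        ∀ (t : ℤ) v, Even (t + ε v) → T (t + 2 * ((n + 1) + (m + 1))) v = T t v) := by
  have h01 := hε.1
  have hpar := hε.isGridParity
  refine ⟨fun lam => ?_, ?_, fun u τ hτ hu => ⟨?_, ?_⟩, fun u τ hτ hu t h1 h2 v hv => ?_,
    fun u ε' τ τ' hε' hu hτ hτ' => ?_, fun lam τ hτ => ?_, fun T hT => ?_⟩
  · obtain ⟨x, hx0, hx1, hx⟩ := exists_tropical_system lam
    refine ⟨x, fun v => ?_, fun v t _ => ?_⟩
    · rcases h01 v with h | h <;> rw [h]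
      · rw [hx0]
      · rw [hx1]
    · rw [hx, tensorQuiver_sum max_comm]
  · obtain ⟨x, hx0, hx1, -, hx⟩ := exists_system (n := n) (m := m)
      (P := IsPositiveFraction (V := Fin n × Fin m)) (fun _ h => h.ne_zero) IsPositiveFraction.one
      (fun _ _ => IsPositiveFraction.mul) (fun _ _ => IsPositiveFraction.add)
      (fun _ _ => IsPositiveFraction.div) IsPositiveFraction.X
    refine ⟨x, fun v => ?_, fun v t _ => ?_⟩
    · rcases h01 v with h | h <;> rw [h]
      · rw [hx0]
      · rw [hx1]
    · rw [hx, tensorQuiver_prod (g := (· + ·)) add_comm]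
  · exact extendTime_eq_rectangleIndicator h01 hpar hu hτ.1 hτ.grid
  · exact extendTime_half_period h01 hpar hu hτ.1 hτ.grid
  · have h := tropical_eq_rectangleIndicator (ε := fun v => 1 - ε v) (τ := fun t => τ (1 - t)) (u := u)
      (fun v => by have := h01 v; omega)
      (fun u v => by have := hpar u v; rw [Int.even_iff] at *; dsimp only; omega) (by simp [hu])
      (fun v => by rw [sub_sub_cancel]; exact hτ.1 v)
      (fun v t ht => by
        have h3 := hτ.grid v (1 - t) (by rw [Int.even_iff] at *; omega)
        rw [← h3, add_comm]
        congr 2 <;> ring)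
      t.toNat (by omega) v
    rw [Int.toNat_of_nonneg (by omega)] at h
    exact h (by rw [Int.even_iff] at *; omega)
  · exact extendTime_add_half_period h01 hpar hε'.1 hε'.isGridParity hu hτ.1 hτ.grid hτ'.1 hτ'.grid
  · exact period_of_half_period hpar (tropical_half_period h01 hpar hτ.grid)
  · have hrec : ∀ v t, Even (t + 1 + ε v) →
        T (t + 1) v * T (t - 1) v = horizontalProd (T t) v + verticalProd (T t) v := fun v t ht => by
      rw [hT.2 v t ht, tensorQuiver_prod (g := (· + ·)) add_comm]
    refine period_of_half_period hpar (field_half_period hpar (fun t v hv => ?_) hrec)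
    exact (system_mem (P := IsPositiveFraction (V := Fin n × Fin m)) (fun _ h => h.ne_zero)
      IsPositiveFraction.one (fun _ _ => IsPositiveFraction.mul) (fun _ _ => IsPositiveFraction.add)
      (fun _ _ => IsPositiveFraction.div) h01 hpar
      (fun v => by rw [hT.1]; exact IsPositiveFraction.X v) hrec t v hv).ne_zero
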